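/- Let $n\ge 1$, $q\ge 2$ and $\tau\ge 1$ be integers. Let $\mathbb H(n,q)=\{0,\dots,q-1\}^n$ with Hamming distance $d$, put $\langle x,y\rangle=1-2d(x,y)/n$ and $T_n=\{-1+2i/n: 0\le i\le n\}$. For a function $h$ on $[-1,1)$ and a nonempty code $C\subset\mathbb H(n,q)$ let $$E(n,C;h)=\frac1{|C|}\sum_{x,y\in C,\ x\ne y}h(\langle x,y\rangle).$$ A code $C$ is a $\tau$-design if, for some integer $\lambda\ge 1$, $|C|=\lambda q^\tau$ and every choice of $\tau$ distinct columns of the $|C|\times n$ matrix whose rows are the codewords contains each word of $\mathbb H(\tau,q)$ exactly $\lambda$ times as a row. Let $\mathcal L(n,M,\tau;h)=\min E(n,C;h)$ over the $\tau$-designs $C\subset\mathbb H(n,q)$ with $|C|=M$, and $\mathcal L(n,M,\tau;h)=\infty$ if there are none. For $k\ge 0$ let $$R(n,2k)=\sum_{i=0}^{k}\binom ni(q-1)^i,\qquad R(n,2k-1)=q\sum_{i=0}^{k-1}\binom{n-1}i(q-1)^i .$$ Let $Q_i(t)=K_i(z)/\big((q-1)^i\binom ni\big)$, $z=n(1-t)/2$,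 where $K_i(z)=\sum_{j=0}^i(-1)^j(q-1)^{i-j}\binom zj\binom{n-z}{i-j}$, $0\le i\le n$, be the normalized Krawtchouk polynomials. For a real polynomial $f$ let $f_0$ be the coefficient of $Q_0$ in the unique expansion $f(t)=\sum_{i=0}^n f_iQ_i(t)$, $t\in T_n$ (an identity of polynomials if $\deg f\le n$). Let $h$ be absolutely monotone on $[-1,1)$, that is, $h$ and all its derivatives exist and are nonnegative on $[-1,1)$. (a) Let $\tau=2k-1$ and let $M$ be an integer with $R(n,2k-1)<M\le R(n,2k)$. There are unique real numbers $-1<\alpha_0<\dots<\alpha_{k-1}<1$ and $\rho_0,\dots,\rho_{k-1}>0$ such that $f_0=\frac{f(1)}M+\sum_{i=0}^{k-1}\rho_if(\alpha_i)$ for all real polynomials $f$ of degree at most $2k-1$, and $$\mathcal L(n,M,\tau;h)\ \ge\ M\sum_{i=0}^{k-1}\rho_i h(\alpha_i).$$ (b) Let $\tau=2k$ and let $M$ be an integer with $R(n,2k)<M\le R(n,2k+1)$. There are unique real numbers $-1=\beta_0<\beta_1<\dots<\beta_k<1$ and $\gamma_0,\dots,\gamma_k>0$ such that $f_0=\frac{f(1)}M+\sum_{i=0}^{k}\gamma_if(\beta_i)$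 for all real polynomials $f$ of degree at most $2k$, and $$\mathcal L(n,M,\tau;h)\ \ge\ M\sum_{i=0}^{k}\gamma_i h(\beta_i).$$ Moreover, in both cases, if $\mathcal L(n,M,\tau;h)<\infty$, then the bound cannot be improved by polynomials of degree at most $\tau$ lying below $h$: its right-hand side equals the maximum value of $f_0M-f(1)$ over all real polynomials $f$ of degree at most $\tau$ with $f(t)\le h(t)$ for every $t\in[-1,1)$. -/

import Mathlib

/-!
Put `Λ f = f_0 - f(1) / M`. In the variable `z = n (1 - t) / 2` the coefficient `f_0` is the mean
of `f` under the binomial distribution, and evaluation at `z = 0` has, on the polynomials of degree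
at most `k`, squared norm `∑ i ≤ k, (n choose i) (q - 1)^i` with respect to this distribution. Hence
`Λ` is positive definite in degree at most `k` as soon as `M` exceeds the Rao bound `R(n, 2k)`; the
weight `1 + t` turns the distribution into the binomial one for `n - 1` and gives the same with
`R(n, 2k+1)`. The nodes and weights are therefore those of the Gauss quadrature of `Λ` (for `τ` odd)
and of its Gauss–Radau quadrature with the node `-1` (for `τ` even).

By Bernstein's theorem `h` is a power series in `t + 1` with nonnegative coefficients, and so are
all its divided differences. The Hermite interpolant `f` of `h` at the nodes, double except for
`-1`, lies below `h` because the error is such a divided difference times a nonnegative nodal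
polynomial. For a `τ`-design `D` and `deg f ≤ τ` the sum of `f(⟨x, y⟩)` over `x, y ∈ D` equals
`f_0 |D|^2`, so the energy is at least `f_0 M - f(1) = M Λ f`, which the quadrature evaluates as a
weighted sum of values of `h`; the same quadrature bounds `M Λ g` for every other polynomial
`g ≤ h` of degree at most `τ`.
-/

open Finset Polynomial

noncomputable section

namespace HammingEnergy

/-- The Hamming space `H(n,q)`: words of length `n` over an alphabet of `q` symbols. -/
abbrev HSpace (n q : ℕ) : Type := Fin n → Fin q

/-- The "inner product" `⟨x,y⟩ = 1 - 2 d(x,y) / n`, with `d` the Hamming distance. -/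
def ip {n q : ℕ} (x y : HSpace n q) : ℝ := 1 - 2 * (hammingDist x y : ℝ) / n

/-- The `h`-energy `E(n,C;h) = |C|⁻¹ ∑_{x ≠ y ∈ C} h(⟨x,y⟩)` of a code `C`. -/
def energy {n q : ℕ} (h : ℝ → ℝ) (C : Finset (HSpace n q)) : ℝ :=
  (1 / (#C : ℝ)) * ∑ x ∈ C, ∑ y ∈ C with x ≠ y, h (ip x y)

/-- `C ⊆ H(n,q)` is a `τ`-design: for some positive index `lam` one has `|C| = lam * q ^ τ`, and
every choice of `τ` distinct columns of the matrix of codewords contains every word of `H(τ,q)`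
exactly `lam` times as a row. -/
def IsDesign {n q : ℕ} (τ : ℕ) (C : Finset (HSpace n q)) : Prop :=
  ∃ lam : ℕ, 0 < lam ∧ #C = lam * q ^ τ ∧
    ∀ (e : Fin τ ↪ Fin n) (y : HSpace τ q), #{x ∈ C | ∀ j, x (e j) = y j} = lam

/-- The minimal `h`-energy `L(n,M,τ;h)` of an `M`-point `τ`-design in `H(n,q)`. There are finitely
many codes, so the infimum is a minimum unless there is no such design, when it is `⊤ = ∞`. -/
def minDesignEnergy (n q M τ : ℕ) (h : ℝ → ℝ) : EReal :=
  ⨅ C ∈ {C : Finset (HSpace n q) | #C = M ∧ IsDesign τ C}, (energy h C : EReal)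

/-- The Rao bound: `R(n,2k-1) = q ∑_{i=0}^{k-1} (n-1 choose i) (q-1)^i` and
`R(n,2k) = ∑_{i=0}^{k} (n choose i) (q-1)^i`. -/
def raoBound (n q τ : ℕ) : ℕ :=
  if Even τ then ∑ i ∈ range (τ / 2 + 1), n.choose i * (q - 1) ^ i
  else q * ∑ i ∈ range ((τ + 1) / 2), (n - 1).choose i * (q - 1) ^ i

/-- The Krawtchouk polynomial `K_i^{(n,q)}(z)`; `Ring.choose` is the generalized binomial
coefficient `z (z-1) ⋯ (z-j+1) / j!`. -/
def krawtchouk (n q i : ℕ) (z : ℝ) : ℝ :=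
  ∑ j ∈ range (i + 1),
    (-1) ^ j * ((q : ℝ) - 1) ^ (i - j) * Ring.choose z j * Ring.choose ((n : ℝ) - z) (i - j)

/-- The normalized Krawtchouk polynomial `Q_i^{(n,q)}(t) = K_i^{(n,q)}(n (1 - t) / 2) / r_i`, where
`r_i = (q-1)^i (n choose i)`. -/
def normKrawtchouk (n q i : ℕ) (t : ℝ) : ℝ :=
  krawtchouk n q i (n * (1 - t) / 2) / (((q : ℝ) - 1) ^ i * n.choose i)

/-- The set `T_n` of the inner products `t_i = -1 + 2 i / n`, `0 ≤ i ≤ n`. -/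
def innerProducts (n : ℕ) : Set ℝ := {t | ∃ i : ℕ, i ≤ n ∧ t = -1 + 2 * (i : ℝ) / n}

/-- `f = ∑_{i=0}^n c_i Q_i^{(n,q)}` on `T_n`. As `T_n` has `n + 1` points, for `deg f ≤ n` this says
that the two sides are equal as polynomials. -/
def IsKrawtchoukExpansion (n q : ℕ) (f : ℝ[X]) (c : Fin (n + 1) → ℝ) : Prop :=
  ∀ t ∈ innerProducts n, f.eval t = ∑ i, c i * normKrawtchouk n q i t

section WellDefined

lemma coeff_one_add_C_mul_X_pow (a : ℝ) (m j : ℕ) :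
    ((1 + C a * X : ℝ[X]) ^ m).coeff j = a ^ j * m.choose j := by
  have : (1 + C a * X : ℝ[X]) ^ m = ((1 + X : ℝ[X]) ^ m).comp (C a * X) := by simp
  rw [this, comp_C_mul_X_coeff, coeff_one_add_X_pow, mul_comm]

/-- The generating polynomial of the values `K_i(z)`, `0 ≤ i ≤ n`, at an integer `z`. -/
def genPoly (n q z : ℕ) : ℝ[X] :=
  (1 + C (-1) * X) ^ z * (1 + C ((q : ℝ) - 1) * X) ^ (n - z)

lemma krawtchouk_natCast {n z : ℕ} (q i : ℕ) (hz : z ≤ n) :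
    krawtchouk n q i z = (genPoly n q z).coeff i := by
  rw [genPoly, coeff_mul, Nat.sum_antidiagonal_eq_sum_range_succ_mk, krawtchouk]
  refine sum_congr rfl fun j _ => ?_
  rw [coeff_one_add_C_mul_X_pow, coeff_one_add_C_mul_X_pow, ← Nat.cast_sub hz,
    Ring.choose_natCast, Ring.choose_natCast]
  ring

lemma eval_genPoly {n z : ℕ} (q : ℕ) (hz : z ≤ n) (x : ℝ) :
    (genPoly n q z).eval x = ∑ j ∈ range (n + 1), krawtchouk n q j z * x ^ j := by
  have hd : (genPoly n q z).natDegree < n + 1 := by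
    have h1 : (1 + C (-1) * X : ℝ[X]).natDegree ≤ 1 := by compute_degree
    have h2 : (1 + C ((q : ℝ) - 1) * X : ℝ[X]).natDegree ≤ 1 := by compute_degree
    have := natDegree_mul_le_of_le (natDegree_pow_le_of_le z h1)
      (natDegree_pow_le_of_le (n - z) h2)
    rw [genPoly]; omega
  rw [eval_eq_sum_range' hd]
  exact sum_congr rfl fun j _ => by rw [krawtchouk_natCast q j hz]

/-- The matrix of the values `K_i(j)` squares to `q^n` times the identity. -/
lemma sum_krawtchouk_mul {n q z : ℕ} (hq : 2 ≤ q) (i : ℕ) (hz : z ≤ n) :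
    ∑ j ∈ range (n + 1), krawtchouk n q i j * krawtchouk n q j z
      = if i = z then (q : ℝ) ^ n else 0 := by
  have key : ∑ j ∈ range (n + 1), C (krawtchouk n q j z) * genPoly n q j
      = C ((q : ℝ) ^ n) * X ^ z := by
    refine eq_of_infinite_eval_eq _ _ ((Set.Ici_infinite (0 : ℝ)).mono fun x hx => ?_)
    have hx : 0 ≤ x := hx
    have hq' : (2 : ℝ) ≤ q := by exact_mod_cast hq
    have hb : 0 < 1 + ((q : ℝ) - 1) * x := by nlinarith
    set b := 1 + ((q : ℝ) - 1) * x with hbd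
    have e := eval_genPoly q hz ((1 - x) / b)
    have e1 : 1 + -1 * ((1 - x) / b) = q * x / b := by field_simp; rw [hbd]; ring
    have e2 : 1 + ((q : ℝ) - 1) * ((1 - x) / b) = q / b := by field_simp; rw [hbd]; ring
    simp only [genPoly, eval_mul, eval_pow, eval_add, eval_one, eval_C, eval_X, e1, e2] at e
    have e3 : (q * x / b) ^ z * (q / b) ^ (n - z) * b ^ n = (q : ℝ) ^ n * x ^ z := by
      obtain ⟨m, rfl⟩ := Nat.exists_eq_add_of_le hz
      rw [Nat.add_sub_cancel_left, div_pow, div_pow, pow_add b, mul_pow, pow_add]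
      field_simp
    simp only [Set.mem_ofPred_eq, eval_finsetSum, genPoly, eval_mul, eval_pow, eval_add, eval_one,
      eval_C, eval_X]
    rw [← e3, e, sum_mul]
    refine sum_congr rfl fun j hj => ?_
    obtain ⟨m, hm⟩ := Nat.exists_eq_add_of_le (Nat.lt_succ_iff.1 (mem_range.1 hj))
    rw [hm, Nat.add_sub_cancel_left, pow_add, div_pow, ← hbd]
    field_simp
    ring
  have := congrArg (fun p => coeff p i) key
  simp only [finsetSum_coeff, coeff_C_mul, coeff_X_pow] at this
  rw [mul_ite, mul_one, mul_zero] at this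
  rw [← this]
  refine sum_congr rfl fun j hj => ?_
  rw [krawtchouk_natCast q i (Nat.lt_succ_iff.1 (mem_range.1 hj)), mul_comm]

/-- Every polynomial has exactly one Krawtchouk expansion. -/
theorem existsUnique_krawtchoukExpansion {n q : ℕ} (hn : 0 < n) (hq : 2 ≤ q) (f : ℝ[X]) :
    ∃! c : Fin (n + 1) → ℝ, IsKrawtchoukExpansion n q f c := by
  have hn' : (n : ℝ) ≠ 0 := by positivity
  have hq0 : (q : ℝ) ^ n ≠ 0 := by positivity
  have hq1 : (0 : ℝ) < (q : ℝ) - 1 := by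
    have : (2 : ℝ) ≤ q := by exact_mod_cast hq
    linarith
  set r : Fin (n + 1) → ℝ := fun i => ((q : ℝ) - 1) ^ (i : ℕ) * n.choose i with hr
  have hr0 : ∀ i, r i ≠ 0 := fun i => by
    have : 0 < n.choose i := Nat.choose_pos (Nat.lt_succ_iff.1 i.2)
    simp only [hr]; positivity
  set g : Fin (n + 1) → ℝ := fun z => f.eval (1 - 2 * (z : ℝ) / n) with hg
  have orth : ∀ i z : Fin (n + 1), ∑ j : Fin (n + 1), krawtchouk n q i j * krawtchouk n q j z
      = if i = z then (q : ℝ) ^ n else 0 := fun i z => by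
    have := sum_krawtchouk_mul hq i (Nat.lt_succ_iff.1 z.2)
    rw [← Fin.sum_univ_eq_sum_range
      (fun j => krawtchouk n q i (j : ℕ) * krawtchouk n q j (z : ℕ))] at this
    simpa [Fin.ext_iff] using this
  have iff1 : ∀ c, IsKrawtchoukExpansion n q f c ↔
      ∀ z : Fin (n + 1), g z = ∑ i, c i / r i * krawtchouk n q i z := by
    intro c
    have hz : ∀ z : Fin (n + 1), (n : ℝ) * (1 - (1 - 2 * (z : ℝ) / n)) / 2 = z := fun z => by
      field_simp; ring
    have hs : ∀ z : Fin (n + 1), ∑ i, c i * normKrawtchouk n q i (1 - 2 * (z : ℝ) / n)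
        = ∑ i, c i / r i * krawtchouk n q i z := fun z => by
      refine sum_congr rfl fun i _ => ?_
      rw [normKrawtchouk, hz]; simp only [hr]; ring
    constructor
    · intro H z
      rw [← hs]
      refine H _ ⟨n - z, Nat.sub_le _ _, ?_⟩
      rw [Nat.cast_sub (Nat.lt_succ_iff.1 z.2)]; field_simp; ring
    · rintro H t ⟨i, hi, rfl⟩
      have ht : -1 + 2 * (i : ℝ) / n
          = 1 - 2 * (((⟨n - i, by omega⟩ : Fin (n + 1)) : ℕ) : ℝ) / n := by
        simp only [Nat.cast_sub hi]; field_simp; ring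
      rw [ht, hs]
      exact H _
  refine ⟨fun i => r i * (((q : ℝ) ^ n)⁻¹ * ∑ z : Fin (n + 1), g z * krawtchouk n q z i),
    (iff1 _).2 fun z => ?_, fun c hc => ?_⟩
  · have h1 : ∀ i : Fin (n + 1), r i * (((q : ℝ) ^ n)⁻¹ * ∑ w : Fin (n + 1),
        g w * krawtchouk n q w i) / r i * krawtchouk n q i z
        = ((q : ℝ) ^ n)⁻¹ * ∑ w : Fin (n + 1),
          g w * (krawtchouk n q w i * krawtchouk n q i z) := fun i => by
      rw [mul_div_cancel_left₀ _ (hr0 i), mul_assoc, sum_mul]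
      simp only [mul_assoc]
    rw [sum_congr rfl fun i _ => h1 i, ← mul_sum, sum_comm]
    simp only [← mul_sum, orth]
    simp only [mul_ite, mul_zero, sum_ite_eq', mem_univ, if_true]
    field_simp
  · funext i
    have h2 := (iff1 c).1 hc
    simp only [h2, sum_mul]
    rw [sum_comm]
    simp only [mul_assoc, ← mul_sum, orth]
    have := hr0 i
    simp
    field_simp

end WellDefined

/-- The coefficients `f_0, …, f_n` of the Krawtchouk expansion of the polynomial `f`. -/
def krawtchoukCoeff (n q : ℕ) (f : ℝ[X]) : Fin (n + 1) → ℝ :=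
  Classical.epsilon (IsKrawtchoukExpansion n q f)

/-- For `n ≥ 1` and `q ≥ 2` the coefficients are the ones of the only Krawtchouk expansion. -/
theorem isKrawtchoukExpansion_iff {n q : ℕ} (hn : 0 < n) (hq : 2 ≤ q) (f : ℝ[X])
    (c : Fin (n + 1) → ℝ) : IsKrawtchoukExpansion n q f c ↔ c = krawtchoukCoeff n q f := by
  have H := existsUnique_krawtchoukExpansion hn hq f
  have hs : IsKrawtchoukExpansion n q f (krawtchoukCoeff n q f) := Classical.epsilon_spec H.exists
  exact ⟨fun h => H.unique h hs, fun h => h ▸ hs⟩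

/-- The nodes `-1 < α_0 < ⋯ < α_{k-1} < 1` and positive weights `ρ_0, …, ρ_{k-1}` of the quadrature
`f_0 = f(1) / M + ∑ ρ_i f(α_i)`, valid for all real polynomials of degree at most `2k-1`. -/
def IsOddQuadrature (n q M k : ℕ) (α ρ : Fin k → ℝ) : Prop :=
  StrictMono α ∧ (∀ i, α i ∈ Set.Ioo (-1 : ℝ) 1) ∧ (∀ i, 0 < ρ i) ∧
    ∀ f : ℝ[X], f.natDegree ≤ 2 * k - 1 →
      krawtchoukCoeff n q f 0 = f.eval 1 / M + ∑ i, ρ i * f.eval (α i)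

/-- The nodes `-1 = β_0 < β_1 < ⋯ < β_k < 1` and positive weights `γ_0, …, γ_k` of the quadrature
`f_0 = f(1) / M + ∑ γ_i f(β_i)`, valid for all real polynomials of degree at most `2k`. -/
def IsEvenQuadrature (n q M k : ℕ) (β γ : Fin (k + 1) → ℝ) : Prop :=
  StrictMono β ∧ β 0 = -1 ∧ (∀ i, β i < 1) ∧ (∀ i, 0 < γ i) ∧
    ∀ f : ℝ[X], f.natDegree ≤ 2 * k →
      krawtchoukCoeff n q f 0 = f.eval 1 / M + ∑ i, γ i * f.eval (β i)

/-- The values `f_0 M - f(1)` of the real polynomials `f` of degree at most `τ` with `f ≤ h` on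
`[-1,1)`. -/
def linearProgramValues (n q M τ : ℕ) (h : ℝ → ℝ) : Set ℝ :=
  {v | ∃ f : ℝ[X], f.natDegree ≤ τ ∧ (∀ t ∈ Set.Ico (-1 : ℝ) 1, f.eval t ≤ h t) ∧
    v = krawtchoukCoeff n q f 0 * M - f.eval 1}

end HammingEnergy

end

noncomputable section

namespace HammingEnergy

section Quadrature

/-- The functional `f ↦ Λ (g f)`, that is, `Λ` weighted by the polynomial `g`. -/
def weighted (g : ℝ[X]) (Λ : ℝ[X] →ₗ[ℝ] ℝ) : ℝ[X] →ₗ[ℝ] ℝ :=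
  Λ ∘ₗ LinearMap.mulLeft ℝ g

/-- `Λ` is positive definite on the polynomials of degree less than `k`: the quadratic form
`p ↦ Λ (p ^ 2)` is positive there away from `0`. -/
def IsPosDefBelow (Λ : ℝ[X] →ₗ[ℝ] ℝ) (k : ℕ) : Prop :=
  ∀ p : ℝ[X], p ≠ 0 → p.degree < k → 0 < Λ (p ^ 2)

/-- `P` is orthogonal, for the bilinear form `(f, g) ↦ Λ (f g)`, to all polynomials of degree less
than `k`. -/
def IsOrthogonalBelow (Λ : ℝ[X] →ₗ[ℝ] ℝ) (k : ℕ) (P : ℝ[X]) : Prop :=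
  ∀ g : ℝ[X], g.degree < k → Λ (P * g) = 0

/-- The quadrature formula with nodes `x` and weights `w` computes `Λ` on the polynomials of degree
less than `N`. -/
def IsQuadrature {ι : Type*} [Fintype ι] (Λ : ℝ[X] →ₗ[ℝ] ℝ) (N : ℕ) (x w : ι → ℝ) : Prop :=
  ∀ f : ℝ[X], f.degree < N → Λ f = ∑ i, w i * f.eval (x i)

/-- A quadrature formula with `k` increasing nodes in `(a, b)` and positive weights that computes
`Λ` in the degrees up to `2 k - 1`. -/
def IsGaussQuadrature (Λ : ℝ[X] →ₗ[ℝ] ℝ) (a b : ℝ) {k : ℕ} (α ρ : Fin k → ℝ) : Prop :=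
  StrictMono α ∧ (∀ i, α i ∈ Set.Ioo a b) ∧ (∀ i, 0 < ρ i) ∧ IsQuadrature Λ (2 * k) α ρ

/-- A quadrature formula with `k + 1` increasing nodes in `[a, b)`, the first of them being `a`, and
positive weights that computes `Λ` in the degrees up to `2 k`. -/
def IsRadauQuadrature (Λ : ℝ[X] →ₗ[ℝ] ℝ) (a b : ℝ) {k : ℕ} (β γ : Fin (k + 1) → ℝ) : Prop :=
  StrictMono β ∧ β 0 = a ∧ (∀ i, β i < b) ∧ (∀ i, 0 < γ i) ∧ IsQuadrature Λ (2 * k + 1) β γ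

lemma weighted_apply (g : ℝ[X]) (Λ : ℝ[X] →ₗ[ℝ] ℝ) (f : ℝ[X]) : weighted g Λ f = Λ (g * f) :=
  rfl

lemma degree_mul_lt_add {R : Type*} [Semiring R] {p f : R[X]} {k m : ℕ}
    (hp : p.natDegree ≤ k) (hf : f.degree < m) : (p * f).degree < (k + m : ℕ) := by
  rw [Nat.cast_add]
  calc (p * f).degree ≤ p.degree + f.degree := degree_mul_le p f
    _ ≤ k + f.degree := by gcongr; exact degree_le_of_natDegree_le hp
    _ < k + m := WithBot.add_lt_add_left WithBot.coe_ne_bot hf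

variable {Λ : ℝ[X] →ₗ[ℝ] ℝ} {k : ℕ}

lemma IsPosDefBelow.mono {m : ℕ} (hΛ : IsPosDefBelow Λ m) (hkm : k ≤ m) : IsPosDefBelow Λ k :=
  fun p hp hdeg => hΛ p hp (hdeg.trans_le (by exact_mod_cast hkm))

lemma exists_monic_orthogonal (hΛ : IsPosDefBelow Λ k) :
    ∃ P : ℝ[X], P.Monic ∧ P.degree = k ∧ IsOrthogonalBelow Λ k P := by
  let B : degreeLT ℝ k →ₗ[ℝ] Module.Dual ℝ (degreeLT ℝ k) :=
    LinearMap.mk₂ ℝ (fun p g => Λ (p * g)) (fun _ _ _ => by simp [add_mul])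
      (fun _ _ _ => by simp) (fun _ _ _ => by simp [mul_add]) (fun _ _ _ => by simp)
  have : FiniteDimensional ℝ (degreeLT ℝ k) := (degreeLTEquiv ℝ k).symm.finiteDimensional
  have injective_B : Function.Injective B := by
    rw [injective_iff_map_eq_zero]
    rintro ⟨p, hp⟩ hBp
    by_contra hne
    have hpos := hΛ p (fun h0 => hne (Subtype.ext h0)) (mem_degreeLT.1 hp)
    have hzero : Λ (p * p) = 0 := LinearMap.congr_fun hBp ⟨p, hp⟩
    rw [pow_two, hzero] at hpos
    exact hpos.false
  have surjective_B : Function.Surjective B :=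
    (LinearMap.injective_iff_surjective_of_finrank_eq_finrank
      Subspace.dual_finrank_eq.symm).1 injective_B
  obtain ⟨⟨p, hp⟩, hBp⟩ := surjective_B (weighted (X ^ k) Λ ∘ₗ (degreeLT ℝ k).subtype)
  rw [mem_degreeLT] at hp
  refine ⟨X ^ k - p, monic_X_pow_sub hp, ?_, fun g hg => ?_⟩
  · rw [degree_sub_eq_left_of_degree_lt (by rwa [degree_X_pow]), degree_X_pow]
  · have hpg : Λ (p * g) = Λ (X ^ k * g) := LinearMap.congr_fun hBp ⟨g, mem_degreeLT.2 hg⟩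
    rw [sub_mul, map_sub, hpg, sub_self]

lemma IsOrthogonalBelow.not_sq_add_sq_dvd (hΛ : IsPosDefBelow Λ k) {P : ℝ[X]} (hP : P ≠ 0)
    (hd : P.degree = k) (horth : IsOrthogonalBelow Λ k P) (a b : ℝ) :
    ¬ ((X - C a) ^ 2 + C (b ^ 2) ∣ P) := by
  rintro ⟨g, rfl⟩
  have hg : g ≠ 0 := right_ne_zero_of_mul hP
  have degree_quadratic : ((X - C a) ^ 2 + C (b ^ 2) : ℝ[X]).degree = (2 : ℕ) := by
    have h2 : ((X - C a) ^ 2 : ℝ[X]).degree = (2 : ℕ) := by simp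
    rw [degree_add_eq_left_of_degree_lt] <;> rw [h2]
    exact degree_C_le.trans_lt (by norm_num)
  have hgk : 2 + g.natDegree = k := by
    rw [degree_mul, degree_quadratic, degree_eq_natDegree hg] at hd
    exact_mod_cast hd
  have hg_lt : g.degree < (g.natDegree + 1 : ℕ) := degree_lt_iff_coeff_zero _ _ |>.2 fun m hm =>
    coeff_eq_zero_of_natDegree_lt hm
  have hg_deg : g.degree < k := hg_lt.trans_le (by norm_cast; omega)
  have hXg_deg : ((X - C a) * g : ℝ[X]).degree < k :=
    (degree_mul_lt_add (natDegree_X_sub_C_le a) hg_lt).trans_le (by norm_cast; omega)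
  have expand : Λ (((X - C a) ^ 2 + C (b ^ 2)) * g * g)
      = Λ (((X - C a) * g) ^ 2) + b ^ 2 * Λ (g ^ 2) := by
    rw [← smul_eq_mul (b ^ 2), ← map_smul, ← map_add, smul_eq_C_mul]
    congr 1
    ring
  have hpos := hΛ _ (mul_ne_zero (X_sub_C_ne_zero a) hg) hXg_deg
  have hnonneg : 0 ≤ b ^ 2 * Λ (g ^ 2) := mul_nonneg (sq_nonneg b) (hΛ g hg hg_deg).le
  linarith [horth g hg_deg]

lemma splits_of_not_sq_add_sq_dvd {P : ℝ[X]}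
    (h : ∀ a b : ℝ, b ≠ 0 → ¬ ((X - C a) ^ 2 + C (b ^ 2) ∣ P)) : P.Splits := by
  rcases eq_or_ne P 0 with rfl | hP
  · exact Splits.zero
  obtain ⟨u, hu⟩ := UniqueFactorizationMonoid.factors_prod hP
  rw [← hu]
  refine (Splits.multisetProd fun g hg => Splits.of_degree_eq_one ?_).mul u.isUnit.splits
  have hgP : g ∣ P := UniqueFactorizationMonoid.dvd_of_mem_factors hg
  have hg : Irreducible g := UniqueFactorizationMonoid.irreducible_of_factor g hg
  obtain ⟨z, hz⟩ := Complex.exists_root (f := g.map (algebraMap ℝ ℂ)) (by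
    rw [degree_map]; exact hg.degree_pos)
  have hz : aeval z g = 0 := by rwa [IsRoot.def, eval_map_algebraMap] at hz
  by_cases him : z.im = 0
  · have hzre : z = algebraMap ℝ ℂ z.re := Complex.ext rfl (by simpa using him)
    rw [hzre, aeval_algebraMap_apply_eq_algebraMap_eval] at hz
    exact degree_eq_one_of_irreducible_of_root hg (by simpa using hz)
  · refine absurd (dvd_trans ?_ hgP) (h z.re z.im him)
    convert g.quadratic_dvd_of_aeval_eq_zero_im_ne_zero hz him using 1
    rw [Complex.sq_norm, Complex.normSq_apply]
    simp only [C_mul, C_add, C_pow, map_ofNat]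
    ring

lemma exists_strictMono_eq_nodal {P : ℝ[X]} (hP : P.Monic) (hd : P.degree = k)
    (h : ∀ a b : ℝ, ¬ ((X - C a) ^ 2 + C (b ^ 2) ∣ P)) :
    ∃ α : Fin k → ℝ, StrictMono α ∧ P = Lagrange.nodal univ α := by
  have hsplit : P.Splits := splits_of_not_sq_add_sq_dvd fun a b _ => h a b
  have hnodup : P.roots.Nodup := by
    rw [Multiset.nodup_iff_count_le_one]
    intro a
    by_contra! hlt
    rw [count_roots] at hlt
    exact h a 0 (by simpa using (le_rootMultiplicity_iff hP.ne_zero).1 hlt)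
  have hcard : #P.roots.toFinset = k := by
    rw [Multiset.toFinset_card_of_nodup hnodup, ← hsplit.natDegree_eq_card_roots]
    exact natDegree_eq_of_degree_eq_some hd
  refine ⟨P.roots.toFinset.orderEmbOfFin hcard, OrderEmbedding.strictMono _, ?_⟩
  conv_lhs => rw [hsplit.eq_prod_roots_of_monic hP]
  rw [Lagrange.nodal, ← prod_image (f := fun a => X - C a)
    (OrderEmbedding.strictMono _).injective.injOn, image_orderEmbOfFin_univ, Finset.prod,
    Multiset.toFinset_val, hnodup.dedup]

/-- Gauss quadrature: interpolation at the zeros of the orthogonal polynomial `P` of degree `k` is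
exact up to degree `2 k - 1` because the quotient of the division by `P` does not contribute. -/
theorem exists_isQuadrature (hΛ : IsPosDefBelow Λ k) :
    ∃ α ρ : Fin k → ℝ, StrictMono α ∧ IsQuadrature Λ (2 * k) α ρ := by
  obtain ⟨P, hP, hd, horth⟩ := exists_monic_orthogonal hΛ
  obtain ⟨α, hα, rfl⟩ := exists_strictMono_eq_nodal hP hd (horth.not_sq_add_sq_dvd hΛ hP.ne_zero hd)
  refine ⟨α, fun i => Λ (Lagrange.basis univ α i), hα, fun f hf => ?_⟩
  set P := Lagrange.nodal univ α
  have degree_quotient : (f /ₘ P).degree < k := by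
    by_contra! hle
    have hPf : P.degree ≤ f.degree := not_lt.1 fun hlt => by
      simp [(divByMonic_eq_zero_iff hP).2 hlt] at hle
    rw [← degree_add_divByMonic hP hPf, hd, two_mul, Nat.cast_add] at hf
    exact hf.not_ge (by gcongr)
  have eval_remainder (i : Fin k) : (f %ₘ P).eval (α i) = f.eval (α i) := by
    conv_rhs => rw [← modByMonic_add_div f P]
    simp [P, Lagrange.eval_nodal_at_node (mem_univ i)]
  have remainder_eq : f %ₘ P = ∑ i, C (f.eval (α i)) * Lagrange.basis univ α i := by
    have := Lagrange.eq_interpolate (f := f %ₘ P) (s := univ) hα.injective.injOn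
      (by simpa using (degree_modByMonic_lt f hP).trans_eq hd)
    simpa only [Lagrange.interpolate_apply, eval_remainder] using this
  calc Λ f = Λ (f %ₘ P) + Λ (P * (f /ₘ P)) := by rw [← map_add, modByMonic_add_div]
    _ = ∑ i, Λ (Lagrange.basis univ α i) * f.eval (α i) := by
      rw [horth _ degree_quotient, add_zero, remainder_eq, map_sum]
      refine sum_congr rfl fun i _ => ?_
      rw [← smul_eq_C_mul, map_smul, smul_eq_mul, mul_comm]

lemma degree_basis_lt {α : Fin k → ℝ} (hα : Function.Injective α) (i : Fin k) :
    (Lagrange.basis univ α i).degree < k := by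
  rw [Lagrange.degree_basis hα.injOn (mem_univ i), card_univ, Fintype.card_fin]
  exact_mod_cast Nat.sub_one_lt i.pos.ne'

lemma IsQuadrature.map_mul_basis_sq {α ρ : Fin k → ℝ} (hquad : IsQuadrature Λ (2 * k) α ρ)
    (hα : Function.Injective α) {g : ℝ[X]} (hg : g.natDegree ≤ 1) (i : Fin k) :
    Λ (g * Lagrange.basis univ α i ^ 2) = ρ i * g.eval (α i) := by
  rw [hquad, sum_eq_single i]
  · simp [Lagrange.eval_basis_self hα.injOn (mem_univ i)]
  · intro j _ hji
    simp [Lagrange.eval_basis_of_ne hji.symm (mem_univ j)]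
  · simp
  · have hb : (Lagrange.basis univ α i).natDegree ≤ k - 1 := by
      simp [Lagrange.natDegree_basis hα.injOn]
    have hdeg := natDegree_mul_le_of_le hg (natDegree_pow_le_of_le 2 hb)
    have := i.pos
    exact degree_le_natDegree.trans_lt (Nat.cast_lt.2 (by omega))

lemma IsQuadrature.weight_mul_eval_pos {α ρ : Fin k → ℝ} (hquad : IsQuadrature Λ (2 * k) α ρ)
    (hα : Function.Injective α) {g : ℝ[X]} (hg : g.natDegree ≤ 1)
    (hpos : IsPosDefBelow (weighted g Λ) k) (i : Fin k) : 0 < ρ i * g.eval (α i) := by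
  rw [← hquad.map_mul_basis_sq hα hg, ← weighted_apply]
  exact hpos _ (Lagrange.basis_ne_zero hα.injOn (mem_univ i)) (degree_basis_lt hα i)

lemma IsQuadrature.isOrthogonalBelow_nodal {α ρ : Fin k → ℝ} (hquad : IsQuadrature Λ (2 * k) α ρ) :
    IsOrthogonalBelow Λ k (Lagrange.nodal univ α) := by
  intro g hg
  rw [hquad]
  · exact sum_eq_zero fun i _ => by simp [Lagrange.eval_nodal_at_node (mem_univ i)]
  · rw [two_mul]
    exact degree_mul_lt_add (by simp [Lagrange.natDegree_nodal]) hg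

lemma eq_of_isOrthogonalBelow (hΛ : IsPosDefBelow Λ k) {P Q : ℝ[X]} (hP : P.Monic) (hQ : Q.Monic)
    (hPk : P.degree = k) (hQk : Q.degree = k) (hP' : IsOrthogonalBelow Λ k P)
    (hQ' : IsOrthogonalBelow Λ k Q) : P = Q := by
  by_contra hne
  have hlt : (P - Q).degree < k := hPk ▸ degree_sub_lt_left (hPk.trans hQk.symm) hP.ne_zero
    (hP.leadingCoeff.trans hQ.leadingCoeff.symm)
  have hpos := hΛ _ (sub_ne_zero.2 hne) hlt
  rw [pow_two, sub_mul, map_sub, hP' _ hlt, hQ' _ hlt, sub_zero] at hpos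
  exact hpos.false

lemma eq_of_nodal_eq {α α' : Fin k → ℝ} (hα : StrictMono α) (hα' : StrictMono α')
    (h : Lagrange.nodal univ α = Lagrange.nodal univ α') : α = α' := by
  have mem_range_iff (α : Fin k → ℝ) (x : ℝ) :
      x ∈ Set.range α ↔ (Lagrange.nodal univ α).eval x = 0 := by
    rw [Lagrange.eval_nodal, prod_eq_zero_iff]
    simp only [Set.mem_range, mem_univ, true_and, sub_eq_zero, eq_comm]
  exact (hα.range_inj hα').1 (Set.ext fun x => by rw [mem_range_iff, mem_range_iff, h])

lemma IsQuadrature.unique (hΛ : IsPosDefBelow Λ k) {α ρ α' ρ' : Fin k → ℝ} (hα : StrictMono α)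
    (hα' : StrictMono α') (hquad : IsQuadrature Λ (2 * k) α ρ)
    (hquad' : IsQuadrature Λ (2 * k) α' ρ') : α = α' ∧ ρ = ρ' := by
  obtain rfl : α = α' := eq_of_nodal_eq hα hα' <| eq_of_isOrthogonalBelow hΛ
    Lagrange.nodal_monic Lagrange.nodal_monic (by simp [Lagrange.degree_nodal])
    (by simp [Lagrange.degree_nodal]) hquad.isOrthogonalBelow_nodal hquad'.isOrthogonalBelow_nodal
  refine ⟨rfl, funext fun i => ?_⟩
  have h := hquad.map_mul_basis_sq hα.injective (g := 1) (by simp) i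
  rw [hquad'.map_mul_basis_sq hα.injective (by simp)] at h
  simpa using h.symm

lemma isPosDefBelow_of_weighted {a b : ℝ} (hab : a < b)
    (ha : IsPosDefBelow (weighted (X - C a) Λ) k) (hb : IsPosDefBelow (weighted (C b - X) Λ) k) :
    IsPosDefBelow Λ k := by
  intro p hp hpk
  have hsum : weighted (X - C a) Λ (p ^ 2) + weighted (C b - X) Λ (p ^ 2)
      = (b - a) * Λ (p ^ 2) := by
    rw [weighted_apply, weighted_apply, ← map_add, ← smul_eq_mul (b - a), ← map_smul,
      smul_eq_C_mul, C_sub]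
    congr 1
    ring
  exact pos_of_mul_pos_right (hsum ▸ add_pos (ha p hp hpk) (hb p hp hpk)) (sub_pos.2 hab).le

theorem existsUnique_isGaussQuadrature {a b : ℝ} (hab : a < b)
    (ha : IsPosDefBelow (weighted (X - C a) Λ) k) (hb : IsPosDefBelow (weighted (C b - X) Λ) k) :
    ∃! p : (Fin k → ℝ) × (Fin k → ℝ), IsGaussQuadrature Λ a b p.1 p.2 := by
  have hΛ := isPosDefBelow_of_weighted hab ha hb
  obtain ⟨α, ρ, hα, hquad⟩ := exists_isQuadrature hΛ
  have hρ (i : Fin k) : 0 < ρ i := by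
    simpa using hquad.weight_mul_eval_pos hα.injective (g := 1) (by simp)
      (by simpa [weighted] using hΛ) i
  have hα_mem (i : Fin k) : α i ∈ Set.Ioo a b := by
    have hleft := hquad.weight_mul_eval_pos hα.injective (natDegree_X_sub_C_le a) ha i
    have hright := hquad.weight_mul_eval_pos hα.injective (by compute_degree) hb i
    simp only [eval_sub, eval_X, eval_C] at hleft hright
    exact ⟨sub_pos.1 (pos_of_mul_pos_right hleft (hρ i).le),
      sub_pos.1 (pos_of_mul_pos_right hright (hρ i).le)⟩
  refine ⟨(α, ρ), ⟨hα, hα_mem, hρ, hquad⟩, fun p hp => ?_⟩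
  exact Prod.ext_iff.2 (hp.2.2.2.unique hΛ hp.1 hα hquad)

lemma IsRadauQuadrature.tail {a b : ℝ} {β γ : Fin (k + 1) → ℝ} (hβ : IsRadauQuadrature Λ a b β γ) :
    IsQuadrature (weighted (X - C a) Λ) (2 * k) (fun i : Fin k => β i.succ)
      (fun i : Fin k => γ i.succ * (β i.succ - a)) := by
  obtain ⟨-, rfl, -, -, hquad⟩ := hβ
  intro f hf
  rw [weighted_apply, hquad _ (add_comm 1 (2 * k) ▸ degree_mul_lt_add (natDegree_X_sub_C_le _) hf),
    Fin.sum_univ_succ]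
  simp [mul_assoc]

lemma IsRadauQuadrature.unique {a b : ℝ} (ha : IsPosDefBelow (weighted (X - C a) Λ) k)
    {β γ β' γ' : Fin (k + 1) → ℝ} (hβ : IsRadauQuadrature Λ a b β γ)
    (hβ' : IsRadauQuadrature Λ a b β' γ') : β = β' ∧ γ = γ' := by
  obtain ⟨htail, hweights⟩ := hβ.tail.unique ha (hβ.1.comp Fin.strictMono_succ)
    (hβ'.1.comp (Fin.strictMono_succ)) (IsRadauQuadrature.tail hβ')
  obtain ⟨hmono, hzero, -, -, hquad⟩ := hβ
  obtain ⟨-, hzero', -, -, hquad'⟩ := hβ'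
  have hsucc (i : Fin k) : γ i.succ = γ' i.succ := by
    have h := congrFun hweights i
    rw [← show β i.succ = β' i.succ from congrFun htail i] at h
    exact mul_right_cancel₀ (sub_pos.2 (hzero ▸ hmono i.succ_pos)).ne' h
  have htotal : ∑ i, γ i = ∑ i, γ' i := by
    have one_deg : (1 : ℝ[X]).degree < (2 * k + 1 : ℕ) := by
      rw [degree_one]
      exact_mod_cast Nat.succ_pos (2 * k)
    simpa using (hquad 1 one_deg).symm.trans (hquad' 1 one_deg)
  rw [Fin.sum_univ_succ, Fin.sum_univ_succ, sum_congr rfl fun i _ => hsucc i] at htotal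
  exact ⟨funext <| Fin.cases (hzero.trans hzero'.symm) (congrFun htail),
    funext <| Fin.cases (add_right_cancel htotal) hsucc⟩

lemma IsQuadrature.of_weighted_X_sub_C {a : ℝ} {α ρ : Fin k → ℝ} (hα : ∀ i, α i ≠ a)
    (hquad : IsQuadrature (weighted (X - C a) Λ) (2 * k) α ρ) :
    IsQuadrature Λ (2 * k + 1) (Fin.cons a α : Fin (k + 1) → ℝ)
      (Fin.cons (Λ 1 - ∑ i, ρ i / (α i - a)) fun i => ρ i / (α i - a)) := by
  intro f hf
  obtain ⟨g, hg⟩ : X - C a ∣ f - C (f.eval a) := X_sub_C_dvd_sub_C_eval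
  have hg_deg : g.degree < (2 * k : ℕ) := by
    by_contra! hle
    have hlt : ((X - C a) * g : ℝ[X]).degree < (2 * k + 1 : ℕ) := hg ▸
      (degree_sub_le _ _).trans_lt
        (max_lt hf (degree_C_le.trans_lt (by exact_mod_cast Nat.succ_pos _)))
    rw [degree_mul, degree_X_sub_C, add_comm, Nat.cast_succ] at hlt
    exact hlt.not_ge (by gcongr)
  have eval_g (i : Fin k) : g.eval (α i) = (f.eval (α i) - f.eval a) / (α i - a) := by
    have h := congrArg (eval (α i)) hg
    simp only [eval_sub, eval_mul, eval_X, eval_C] at h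
    rw [h, mul_div_cancel_left₀ _ (sub_ne_zero.2 (hα i))]
  calc Λ f = Λ (f.eval a • 1 + (X - C a) * g) := by rw [← hg, smul_eq_C_mul]; simp
    _ = f.eval a * Λ 1 + ∑ i, ρ i * ((f.eval (α i) - f.eval a) / (α i - a)) := by
      rw [map_add, map_smul, smul_eq_mul, ← weighted_apply, hquad g hg_deg]
      simp only [eval_g]
    _ = _ := by
      simp only [Fin.sum_univ_succ, Fin.cons_zero, Fin.cons_succ, sub_mul, sum_mul]
      rw [sub_add, ← sum_sub_distrib, mul_comm, sub_eq_add_neg, ← sum_neg_distrib]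
      exact congrArg _ (sum_congr rfl fun i _ => by ring)

theorem existsUnique_isRadauQuadrature {a b : ℝ} (hab : a < b) (hΛ : IsPosDefBelow Λ (k + 1))
    (hW : IsPosDefBelow (weighted ((X - C a) * (C b - X)) Λ) k) :
    ∃! p : (Fin (k + 1) → ℝ) × (Fin (k + 1) → ℝ), IsRadauQuadrature Λ a b p.1 p.2 := by
  have hsq : IsPosDefBelow (weighted (X - C a) (weighted (X - C a) Λ)) k := fun p hp hpk => by
    rw [weighted_apply, weighted_apply, ← mul_assoc, ← pow_two, ← mul_pow]
    exact hΛ _ (mul_ne_zero (X_sub_C_ne_zero a) hp)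
      (add_comm 1 k ▸ degree_mul_lt_add (natDegree_X_sub_C_le a) hpk)
  have hW : IsPosDefBelow (weighted (C b - X) (weighted (X - C a) Λ)) k := fun p hp hpk => by
    simpa only [weighted_apply, mul_assoc] using hW p hp hpk
  obtain ⟨⟨α, ρ⟩, ⟨hα, hα_mem, hρ, hquad⟩, -⟩ := existsUnique_isGaussQuadrature hab hsq hW
  dsimp only at hα hα_mem hρ hquad
  have hquad := hquad.of_weighted_X_sub_C fun i => (hα_mem i).1.ne'
  set γ₀ := Λ 1 - ∑ i, ρ i / (α i - a)
  have hγ₀ : 0 < γ₀ := by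
    have hpos := hΛ (Lagrange.nodal univ α) Lagrange.nodal_ne_zero (by
      rw [Lagrange.degree_nodal]; exact Nat.cast_lt.2 (by simp))
    have hdeg : ((Lagrange.nodal univ α) ^ 2).degree < (2 * k + 1 : ℕ) := by
      rw [degree_pow, Lagrange.degree_nodal, card_univ, Fintype.card_fin, nsmul_eq_mul]
      exact_mod_cast Nat.lt_succ_self _
    rw [hquad _ hdeg, Fin.sum_univ_succ, sum_eq_zero (s := univ) fun i _ => by
      simp [Lagrange.eval_nodal_at_node (mem_univ i)], add_zero] at hpos
    exact pos_of_mul_pos_left hpos (by simp [sq_nonneg])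
  have hradau : IsRadauQuadrature Λ a b (Fin.cons a α : Fin (k + 1) → ℝ)
      (Fin.cons γ₀ fun i => ρ i / (α i - a)) :=
    ⟨Fin.strictMono_cons.2 ⟨fun i => (hα_mem i).1, hα⟩, rfl, Fin.cases hab fun i => (hα_mem i).2,
      Fin.cases hγ₀ fun i => div_pos (hρ i) (sub_pos.2 (hα_mem i).1), hquad⟩
  exact ⟨(_, _), hradau, fun p hp =>
    Prod.ext_iff.2 (IsRadauQuadrature.unique (isPosDefBelow_of_weighted hab hsq hW) hp hradau)⟩

end Quadrature

section AbsolutelyMonotone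

open Filter Topology
open scoped Nat

variable {a b : ℝ} {h : ℝ → ℝ}

/-- `d 0, d 1, d 2, …` are successive derivatives of each other on `[a, b)` and all of them are
nonnegative there. -/
def IsNonnegDerivChain (a b : ℝ) (d : ℕ → ℝ → ℝ) : Prop :=
  ∀ m, ∀ x ∈ Set.Ico a b, 0 ≤ d m x ∧ HasDerivWithinAt (d m) (d (m + 1) x) (Set.Ico a b) x

/-- The remainder at `x` of the Taylor polynomial of order `n` at `a` built from the successive
derivatives `d 0, d 1, …`. -/
def taylorRemainder (d : ℕ → ℝ → ℝ) (a : ℝ) (n : ℕ) (x : ℝ) : ℝ :=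
  d 0 x - ∑ m ∈ range n, d m a / m ! * (x - a) ^ m

/-- On `[a, b)`, the function `h` is the sum of a power series in `t - a` with nonnegative
coefficients. -/
def HasNonnegSeries (a b : ℝ) (h : ℝ → ℝ) : Prop :=
  ∃ c : ℕ → ℝ, (∀ m, 0 ≤ c m) ∧
    ∀ t ∈ Set.Ico a b, HasSum (fun m => c m * (t - a) ^ m) (h t)

lemma isNonnegDerivChain_iteratedDerivWithin (hh : AbsolutelyMonotoneOn h (Set.Ico a b)) :
    IsNonnegDerivChain a b fun m => iteratedDerivWithin m h (Set.Ico a b) := by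
  intro m x hx
  have hs := uniqueDiffOn_Ico a b
  refine ⟨hh.iteratedDerivWithin_nonneg hs m hx, ?_⟩
  simp only [iteratedDerivWithin_succ]
  exact (hh.contDiffOn.differentiableOn_iteratedDerivWithin
    (by exact_mod_cast WithTop.coe_lt_top _) hs x hx).hasDerivWithinAt

lemma monotoneOn_Ico_of_hasDerivWithinAt_nonneg {f f' : ℝ → ℝ}
    (hf : ∀ x ∈ Set.Ico a b, HasDerivWithinAt f (f' x) (Set.Ico a b) x)
    (hf' : ∀ x ∈ Set.Ico a b, 0 ≤ f' x) : MonotoneOn f (Set.Ico a b) := by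
  refine monotoneOn_of_hasDerivWithinAt_nonneg (f' := f') (convex_Ico a b)
    (fun x hx => (hf x hx).continuousWithinAt) (fun x hx => ?_)
    (fun x hx => hf' x (interior_subset hx))
  exact (hf x (interior_subset hx)).mono interior_subset

lemma nonneg_of_hasDerivWithinAt_nonneg {f f' : ℝ → ℝ} (ha : 0 ≤ f a)
    (hf : ∀ x ∈ Set.Ico a b, HasDerivWithinAt f (f' x) (Set.Ico a b) x)
    (hf' : ∀ x ∈ Set.Ico a b, 0 ≤ f' x) {x : ℝ} (hx : x ∈ Set.Ico a b) : 0 ≤ f x :=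
  ha.trans <| monotoneOn_Ico_of_hasDerivWithinAt_nonneg hf hf' ⟨le_rfl, hx.1.trans_lt hx.2⟩ hx hx.1

lemma IsNonnegDerivChain.succ {d : ℕ → ℝ → ℝ} (hd : IsNonnegDerivChain a b d) :
    IsNonnegDerivChain a b fun m => d (m + 1) :=
  fun m => hd (m + 1)

lemma taylorRemainder_succ_self (d : ℕ → ℝ → ℝ) (a : ℝ) (n : ℕ) :
    taylorRemainder d a (n + 1) a = 0 := by
  simp [taylorRemainder, sum_range_succ']

lemma hasDerivWithinAt_taylorRemainder {d : ℕ → ℝ → ℝ} {s : Set ℝ} {x : ℝ} (n : ℕ)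
    (hd : HasDerivWithinAt (d 0) (d 1 x) s x) :
    HasDerivWithinAt (taylorRemainder d a (n + 1)) (taylorRemainder (fun m => d (m + 1)) a n x)
      s x := by
  have hpow (m : ℕ) : HasDerivAt (fun y => d (m + 1) a / (m + 1)! * (y - a) ^ (m + 1))
      (d (m + 1) a / m ! * (x - a) ^ m) x := by
    convert! ((hasDerivAt_id' x).sub_const a).fun_pow (m + 1) |>.const_mul
      (d (m + 1) a / (m + 1)!) using 1
    rw [Nat.factorial_succ]
    push_cast
    field_simp
  have hsum := (HasDerivAt.fun_sum fun m (_ : m ∈ range n) => hpow m).add_const (d 0 a)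
  convert! hd.sub hsum.hasDerivWithinAt using 1
  ext y
  simp [taylorRemainder, sum_range_succ']

lemma IsNonnegDerivChain.taylorRemainder_nonneg {d : ℕ → ℝ → ℝ} (hd : IsNonnegDerivChain a b d)
    (n : ℕ) {x : ℝ} (hx : x ∈ Set.Ico a b) : 0 ≤ taylorRemainder d a n x := by
  induction n generalizing d x with
  | zero => simpa [taylorRemainder] using (hd 0 x hx).1
  | succ n ih =>
    exact nonneg_of_hasDerivWithinAt_nonneg (taylorRemainder_succ_self d a n).ge
      (fun y hy => hasDerivWithinAt_taylorRemainder n (hd 0 y hy).2) (fun y hy => ih hd.succ hy) hx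

lemma scale_mem_Ico {s x : ℝ} (hs : s ∈ Set.Icc (0 : ℝ) 1) (hx : x ∈ Set.Ico a b) :
    a + s * (x - a) ∈ Set.Ico a b := by
  have hxa := sub_nonneg.2 hx.1
  have hle := mul_le_of_le_one_left hxa hs.2
  exact ⟨le_add_of_nonneg_right (mul_nonneg hs.1 hxa), by linarith [hx.2]⟩

lemma IsNonnegDerivChain.taylorRemainder_scale_le {d : ℕ → ℝ → ℝ} (hd : IsNonnegDerivChain a b d)
    (n : ℕ) {s : ℝ} (hs : s ∈ Set.Icc (0 : ℝ) 1) {x : ℝ} (hx : x ∈ Set.Ico a b) :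
    taylorRemainder d a n (a + s * (x - a)) ≤ s ^ n * taylorRemainder d a n x := by
  rw [← sub_nonneg]
  induction n generalizing d x with
  | zero =>
    have hmono : MonotoneOn (d 0) (Set.Ico a b) := monotoneOn_Ico_of_hasDerivWithinAt_nonneg
      (fun y hy => (hd 0 y hy).2) (fun y hy => (hd 1 y hy).1)
    have hle : a + s * (x - a) ≤ x := by
      linarith [mul_le_of_le_one_left (sub_nonneg.2 hx.1) hs.2]
    simpa [taylorRemainder] using hmono (scale_mem_Ico hs hx) hx hle
  | succ n ih =>
    refine nonneg_of_hasDerivWithinAt_nonneg (a := a) (b := b)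
      (f := fun x => s ^ (n + 1) * taylorRemainder d a (n + 1) x
        - taylorRemainder d a (n + 1) (a + s * (x - a)))
      (f' := fun x => s * (s ^ n * taylorRemainder (fun m => d (m + 1)) a n x
        - taylorRemainder (fun m => d (m + 1)) a n (a + s * (x - a)))) ?_ (fun y hy => ?_)
      (fun y hy => mul_nonneg hs.1 (ih hd.succ hy)) hx
    · simp [taylorRemainder_succ_self]
    · have hscale : HasDerivWithinAt (fun y => a + s * (y - a)) s (Set.Ico a b) y := by
        simpa using (((hasDerivAt_id' y).sub_const a).const_mul s).const_add a |>.hasDerivWithinAt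
      have hR := hasDerivWithinAt_taylorRemainder (a := a) n (hd 0 y hy).2
      have hRs :=
        (hasDerivWithinAt_taylorRemainder (a := a) n (hd 0 _ (scale_mem_Ico hs hy)).2).comp y hscale
        fun z hz => scale_mem_Ico hs hz
      convert! (hR.const_mul (s ^ (n + 1))).sub hRs using 1
      ring

/-- Bernstein's theorem. The Taylor remainder of order `n` at `a`, divided by `(x - a) ^ n`,
increases with `x`; comparing `x` with some `y > x` shows that the remainder at `x` tends to
zero. -/
theorem hasNonnegSeries_of_absolutelyMonotoneOn (hab : a < b)
    (hh : AbsolutelyMonotoneOn h (Set.Ico a b)) :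
    HasNonnegSeries a b h := by
  have hd := isNonnegDerivChain_iteratedDerivWithin hh
  set d := fun m => iteratedDerivWithin m h (Set.Ico a b)
  have hcoeff (m : ℕ) : 0 ≤ d m a / m ! := div_nonneg (hd m a ⟨le_rfl, hab⟩).1 (by positivity)
  refine ⟨fun m => d m a / m !, hcoeff, fun x hx => ?_⟩
  obtain ⟨y, hxy, hyb⟩ := exists_between hx.2
  have hy : y ∈ Set.Ico a b := ⟨hx.1.trans hxy.le, hyb⟩
  have hay : 0 < y - a := sub_pos.2 (hx.1.trans_lt hxy)
  have hs : (x - a) / (y - a) ∈ Set.Ico (0 : ℝ) 1 :=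
    ⟨div_nonneg (sub_nonneg.2 hx.1) hay.le, (div_lt_one hay).2 (sub_lt_sub_right hxy a)⟩
  have hupper (n : ℕ) : taylorRemainder d a n x ≤ ((x - a) / (y - a)) ^ n * d 0 y := by
    have hscale := hd.taylorRemainder_scale_le n (Set.Ico_subset_Icc_self hs) hy
    rw [div_mul_cancel₀ _ hay.ne', add_sub_cancel] at hscale
    refine hscale.trans (mul_le_mul_of_nonneg_left ?_ (pow_nonneg hs.1 n))
    exact sub_le_self _ (sum_nonneg fun m _ => mul_nonneg (hcoeff m) (pow_nonneg hay.le m))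
  have hlim : Tendsto (fun n => taylorRemainder d a n x) atTop (𝓝 0) := by
    refine squeeze_zero (fun n => hd.taylorRemainder_nonneg n hx) hupper ?_
    simpa using (tendsto_pow_atTop_nhds_zero_of_lt_one hs.1 hs.2).mul_const (d 0 y)
  rw [hasSum_iff_tendsto_nat_of_nonneg fun m =>
    mul_nonneg (hcoeff m) (pow_nonneg (sub_nonneg.2 hx.1) m)]
  simpa [taylorRemainder, d] using hlim.const_sub (d 0 x)

lemma HasNonnegSeries.nonneg (hh : HasNonnegSeries a b h) {t : ℝ} (ht : t ∈ Set.Ico a b) :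
    0 ≤ h t := by
  obtain ⟨c, hc, hsum⟩ := hh
  exact (hsum t ht).nonneg fun m => mul_nonneg (hc m) (pow_nonneg (sub_nonneg.2 ht.1) m)

lemma hasSum_antidiagonal {f : ℕ × ℕ → ℝ} {s : ℝ} (hf : HasSum f s) :
    HasSum (fun n => ∑ p ∈ antidiagonal n, f p) s := by
  refine ((HasAntidiagonal.sigmaAntidiagonalEquivProd (A := ℕ)).hasSum_iff.2 hf).sigma fun n => ?_
  rw [← sum_coe_sort]
  exact hasSum_fintype _

lemma summable_of_summable_sum_antidiagonal {f : ℕ × ℕ → ℝ} (hf : ∀ p, 0 ≤ f p)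
    (hsum : Summable fun n => ∑ p ∈ antidiagonal n, f p) : Summable f := by
  refine (HasAntidiagonal.sigmaAntidiagonalEquivProd (A := ℕ)).summable_iff.1 ?_
  refine (summable_sigma_of_nonneg fun p => hf _).2 ⟨fun n => (hasSum_fintype _).summable, ?_⟩
  refine hsum.congr fun n => ?_
  rw [tsum_fintype, ← sum_coe_sort]
  rfl

lemma sum_antidiagonal_pow_mul_pow (u v : ℝ) (n : ℕ) :
    (v - u) * ∑ p ∈ antidiagonal n, v ^ p.1 * u ^ p.2 = v ^ (n + 1) - u ^ (n + 1) := by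
  rw [Finset.Nat.sum_antidiagonal_eq_sum_range_succ fun i j => v ^ i * u ^ j, mul_comm]
  exact geom_sum₂_mul v u (n + 1)

lemma sum_antidiagonal_mul_pow_mul_pow (c : ℕ → ℝ) (u v : ℝ) (n : ℕ) :
    ∑ p ∈ antidiagonal n, (v - u) * (c (p.1 + p.2 + 1) * (v ^ p.1 * u ^ p.2)) =
      c (n + 1) * (v ^ (n + 1) - u ^ (n + 1)) := by
  rw [← sum_antidiagonal_pow_mul_pow, mul_sum, mul_sum]
  refine sum_congr rfl fun p hp => ?_
  rw [Finset.HasAntidiagonal.mem_antidiagonal.1 hp]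
  ring

lemma summable_mul_pow_mul_pow {c : ℕ → ℝ} (hc : ∀ m, 0 ≤ c m) {u v w : ℝ} (hu : 0 ≤ u)
    (hv : 0 ≤ v) (huw : u < w) (hvw : v ≤ w) (hw : Summable fun m => c m * w ^ m)
    (hu_sum : Summable fun m => c m * u ^ m) :
    Summable fun p : ℕ × ℕ => c (p.1 + p.2 + 1) * (v ^ p.1 * u ^ p.2) := by
  have hw0 : 0 ≤ w := hu.trans huw.le
  have hnonneg (p : ℕ × ℕ) : 0 ≤ (w - u) * (c (p.1 + p.2 + 1) * (w ^ p.1 * u ^ p.2)) :=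
    mul_nonneg (sub_nonneg.2 huw.le) (mul_nonneg (hc _) (by positivity))
  have hsum : Summable fun p : ℕ × ℕ =>
      (w - u) * (c (p.1 + p.2 + 1) * (w ^ p.1 * u ^ p.2)) := by
    refine summable_of_summable_sum_antidiagonal hnonneg ?_
    simpa only [sum_antidiagonal_mul_pow_mul_pow, mul_sub] using
      (summable_nat_add_iff 1).2 (hw.sub hu_sum)
  refine ((summable_mul_left_iff (sub_pos.2 huw).ne').1 hsum).of_nonneg_of_le
    (fun p => mul_nonneg (hc _) (by positivity)) fun p => ?_
  have := hc (p.1 + p.2 + 1)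
  gcongr

/-- The coefficients of the divided difference of `∑ c m * v ^ m` at `u` are
`∑ j, c (i + j + 1) * u ^ j`. -/
lemma HasNonnegSeries.exists_eq_add_sub_mul (hh : HasNonnegSeries a b h) {x : ℝ}
    (hx : x ∈ Set.Ico a b) :
    ∃ g, HasNonnegSeries a b g ∧ ∀ t ∈ Set.Ico a b, h t = h x + (t - x) * g t := by
  obtain ⟨c, hc, hsum⟩ := hh
  have hx0 : 0 ≤ x - a := sub_nonneg.2 hx.1
  let A (t : ℝ) (p : ℕ × ℕ) : ℝ := c (p.1 + p.2 + 1) * ((t - a) ^ p.1 * (x - a) ^ p.2)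
  have hA {t : ℝ} (ht : t ∈ Set.Ico a b) : HasSum (A t) (∑' p, A t p) := by
    obtain ⟨y, hy, hyb⟩ := exists_between (max_lt hx.2 ht.2)
    obtain ⟨hxy, hty⟩ := max_lt_iff.1 hy
    exact (summable_mul_pow_mul_pow hc hx0 (sub_nonneg.2 ht.1) (sub_lt_sub_right hxy a)
      (sub_le_sub_right hty.le a) (hsum y ⟨hx.1.trans hxy.le, hyb⟩).summable
      (hsum x hx).summable).hasSum
  refine ⟨fun t => ∑' p, A t p,
    ⟨fun i => ∑' j, c (i + j + 1) * (x - a) ^ j, fun i => tsum_nonneg fun j =>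
      mul_nonneg (hc _) (pow_nonneg hx0 j), fun t ht => ?_⟩, fun t ht => ?_⟩
  · have hfiber (i : ℕ) := (hA ht).summable.prod_factor i
    convert! (hA ht).prod_fiberwise fun i => (hfiber i).hasSum using 2 with i
    rw [← tsum_mul_right]
    exact tsum_congr fun j => by ring
  · have hlhs := (hasSum_nat_add_iff' 1).2 ((hsum t ht).sub (hsum x hx))
    have hrhs := hasSum_antidiagonal ((hA ht).mul_left (t - x))
    have hterm (n : ℕ) : ∑ p ∈ antidiagonal n, (t - x) * A t p =
        c (n + 1) * (t - a) ^ (n + 1) - c (n + 1) * (x - a) ^ (n + 1) := by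
      rw [← mul_sub, ← sum_antidiagonal_mul_pow_mul_pow, sub_sub_sub_cancel_right]
    simp only [hterm] at hrhs
    have heq := hlhs.unique hrhs
    simp only [range_one, sum_singleton, pow_zero, mul_one, sub_self, sub_zero] at heq
    rw [← heq]
    ring

theorem HasNonnegSeries.exists_newton_interpolation (hh : HasNonnegSeries a b h)
    {s : Multiset ℝ} (hs : ∀ x ∈ s, x ∈ Set.Ico a b) :
    ∃ (f : ℝ[X]) (g : ℝ → ℝ), f.degree < s.card ∧ HasNonnegSeries a b g ∧
      ∀ t ∈ Set.Ico a b, h t = f.eval t + (s.map fun x => t - x).prod * g t := by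
  induction s using Multiset.induction_on generalizing h with
  | empty => exact ⟨0, h, by simp, hh, by simp⟩
  | cons x s ih =>
    obtain ⟨g, hg, hhg⟩ := hh.exists_eq_add_sub_mul (hs x (Multiset.mem_cons_self x s))
    obtain ⟨f, r, hf, hr, hgf⟩ := ih hg fun y hy => hs y (Multiset.mem_cons_of_mem hy)
    refine ⟨C (h x) + (X - C x) * f, r, ?_, hr, fun t ht => ?_⟩
    · rw [Multiset.card_cons]
      refine (degree_add_le _ _).trans_lt (max_lt (degree_C_le.trans_lt (by norm_cast; simp)) ?_)
      rw [add_comm s.card]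
      exact degree_mul_lt_add (natDegree_X_sub_C x).le hf
    · rw [hhg t ht, hgf t ht, Multiset.map_cons, Multiset.prod_cons]
      simp only [eval_add, eval_mul, eval_sub, eval_C, eval_X]
      ring

theorem exists_minorant_of_prod_nonneg (hab : a < b) (hh : AbsolutelyMonotoneOn h (Set.Ico a b))
    {s : Multiset ℝ} (hs : ∀ x ∈ s, x ∈ Set.Ico a b)
    (hprod : ∀ t ∈ Set.Ico a b, 0 ≤ (s.map fun x => t - x).prod) :
    ∃ f : ℝ[X], f.degree < s.card ∧ (∀ t ∈ Set.Ico a b, f.eval t ≤ h t) ∧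
      ∀ x ∈ s, f.eval x = h x := by
  obtain ⟨f, g, hf, hg, hfg⟩ :=
    (hasNonnegSeries_of_absolutelyMonotoneOn hab hh).exists_newton_interpolation hs
  refine ⟨f, hf, fun t ht => ?_, fun x hx => ?_⟩
  · rw [hfg t ht]
    exact le_add_of_nonneg_right (mul_nonneg (hprod t ht) (hg.nonneg ht))
  · have hzero : (s.map fun y => x - y).prod = 0 :=
      Multiset.prod_eq_zero (Multiset.mem_map.2 ⟨x, hx, sub_self x⟩)
    rw [hfg x (hs x hx), hzero, zero_mul, add_zero]

theorem exists_minorant_at_double_nodes (hab : a < b)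
    (hh : AbsolutelyMonotoneOn h (Set.Ico a b)) {k : ℕ} {α : Fin k → ℝ}
    (hα : ∀ i, α i ∈ Set.Ico a b) :
    ∃ f : ℝ[X], f.degree < (2 * k : ℕ) ∧ (∀ t ∈ Set.Ico a b, f.eval t ≤ h t) ∧
      ∀ i, f.eval (α i) = h (α i) := by
  obtain ⟨f, hdeg, hle, heq⟩ := exists_minorant_of_prod_nonneg hab hh
    (s := univ.val.map α + univ.val.map α) (by simpa using hα) fun t _ => by
      rw [Multiset.map_add, Multiset.prod_add]
      exact mul_self_nonneg _
  exact ⟨f, by simpa [two_mul] using hdeg, hle, fun i => heq _ (by simp)⟩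

theorem exists_minorant_at_left_end_and_double_nodes (hab : a < b)
    (hh : AbsolutelyMonotoneOn h (Set.Ico a b)) {k : ℕ} {β : Fin (k + 1) → ℝ} (hβ0 : β 0 = a)
    (hβ : ∀ i, β i ∈ Set.Ico a b) :
    ∃ f : ℝ[X], f.degree < (2 * k + 1 : ℕ) ∧ (∀ t ∈ Set.Ico a b, f.eval t ≤ h t) ∧
      ∀ i, f.eval (β i) = h (β i) := by
  let s : Multiset ℝ := univ.val.map fun i : Fin k => β i.succ
  obtain ⟨f, hdeg, hle, heq⟩ := exists_minorant_of_prod_nonneg hab hh (s := a ::ₘ (s + s))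
    (by simpa [s, hab] using fun i : Fin k => hβ i.succ) fun t ht => by
      rw [Multiset.map_cons, Multiset.prod_cons, Multiset.map_add, Multiset.prod_add]
      exact mul_nonneg (sub_nonneg.2 ht.1) (mul_self_nonneg _)
  refine ⟨f, by simpa [s, two_mul] using hdeg, hle, Fin.cases ?_ fun i => heq _ (by simp [s])⟩
  rw [hβ0]
  exact heq a (Multiset.mem_cons_self _ _)

end AbsolutelyMonotone

section BinomialMean

open scoped Nat

lemma map_eq_zero_of_descPochhammer {V : Type*} [AddCommGroup V] [Module ℝ V] {Φ : ℝ[X] →ₗ[ℝ] V}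
    {m : ℕ} (hΦ : ∀ j < m, Φ (descPochhammer ℝ j) = 0) {f : ℝ[X]} (hf : f.degree < m) :
    Φ f = 0 := by
  let S : Polynomial.Sequence ℝ := ⟨descPochhammer ℝ, fun j => by
    rw [degree_eq_natDegree (monic_descPochhammer ℝ j).ne_zero, descPochhammer_natDegree]⟩
  have hspan : Submodule.span ℝ (S '' Set.Iio m) = degreeLT ℝ m := S.span_degreeLT fun i _ => by
    simp [S, (monic_descPochhammer ℝ i).leadingCoeff]
  have hle : degreeLT ℝ m ≤ Φ.ker := by
    rw [← hspan, Submodule.span_le]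
    rintro _ ⟨j, hj, rfl⟩
    exact hΦ j hj
  exact hle (mem_degreeLT.2 hf)

lemma descPochhammer_eval_natCast (j z : ℕ) :
    (descPochhammer ℝ j).eval (z : ℝ) = j ! * z.choose j := by
  rw [descPochhammer_eval_eq_descFactorial, Nat.descFactorial_eq_factorial_mul_choose,
    Nat.cast_mul]

/-- The expectation of `f z`, where `z` is the distance of a uniformly random word of length `N`
over an alphabet of size `q` to a fixed word. -/
def binomialMean (N q : ℕ) : ℝ[X] →ₗ[ℝ] ℝ :=
  ((q : ℝ) ^ N)⁻¹ • ∑ z ∈ range (N + 1), ((N.choose z : ℝ) * ((q : ℝ) - 1) ^ z) • leval (z : ℝ)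

variable {n q : ℕ}

lemma binomialMean_apply (n q : ℕ) (f : ℝ[X]) :
    binomialMean n q f = ((q : ℝ) ^ n)⁻¹ *
      ∑ z ∈ range (n + 1), (n.choose z : ℝ) * ((q : ℝ) - 1) ^ z * f.eval (z : ℝ) := by
  simp [binomialMean, leval]

lemma binomialMean_nonneg (hq : 0 < q) {f : ℝ[X]} (hf : ∀ z ≤ n, 0 ≤ f.eval (z : ℝ)) :
    0 ≤ binomialMean n q f := by
  have hq1 : (0 : ℝ) ≤ q - 1 := sub_nonneg.2 (by exact_mod_cast hq)
  rw [binomialMean_apply]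
  refine mul_nonneg (by positivity) (sum_nonneg fun z hz => mul_nonneg (by positivity) ?_)
  exact hf z (Nat.lt_succ_iff.1 (mem_range.1 hz))

lemma binomialMean_pos (hq : 1 < q) {f : ℝ[X]} (hf : ∀ z ≤ n, 0 ≤ f.eval (z : ℝ))
    {w : ℕ} (hwn : w ≤ n) (hw : f.eval (w : ℝ) ≠ 0) : 0 < binomialMean n q f := by
  have hq1 : (0 : ℝ) < q - 1 := sub_pos.2 (by exact_mod_cast hq)
  have hq0 : (0 : ℝ) < q := by linarith
  rw [binomialMean_apply]
  refine mul_pos (by positivity) (sum_pos' (fun z hz => mul_nonneg (by positivity) ?_)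
    ⟨w, mem_range.2 (Nat.lt_succ_iff.2 hwn), mul_pos ?_ ((hf w hwn).lt_of_ne' hw)⟩)
  · exact hf z (Nat.lt_succ_iff.1 (mem_range.1 hz))
  · have := Nat.choose_pos hwn
    positivity

lemma sum_choose_mul_choose_mul_pow {R : Type*} [CommRing R] (n j : ℕ) (A B : R) :
    ∑ z ∈ range (n + 1), (n.choose z : R) * (z.choose j : R) * (A ^ z * B ^ (n - z))
      = (n.choose j : R) * (A ^ j * (A + B) ^ (n - j)) := by
  rcases lt_or_ge n j with hj | hj
  · rw [Nat.choose_eq_zero_of_lt hj, Nat.cast_zero, zero_mul]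
    refine sum_eq_zero fun z hz => ?_
    rw [Nat.choose_eq_zero_of_lt ((mem_range_succ_iff.1 hz).trans_lt hj)]
    simp
  · obtain ⟨m, rfl⟩ := Nat.exists_eq_add_of_le hj
    have hlow : ∑ z ∈ range j, ((j + m).choose z : R) * (z.choose j : R) *
        (A ^ z * B ^ (j + m - z)) = 0 := by
      refine sum_eq_zero fun z hz => ?_
      rw [Nat.choose_eq_zero_of_lt (mem_range.1 hz)]
      simp
    rw [add_assoc, sum_range_add, hlow, zero_add, Nat.add_sub_cancel_left, add_pow, mul_sum,
      mul_sum]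
    refine sum_congr rfl fun z _ => ?_
    have hchoose := Nat.choose_mul (n := j + m) (Nat.le_add_right j z)
    rw [Nat.add_sub_cancel_left, Nat.add_sub_cancel_left] at hchoose
    rw [← Nat.cast_mul, hchoose, Nat.add_sub_add_left]
    push_cast
    ring

/-- The Krawtchouk polynomial of degree `i` as an element of `ℝ[X]`. -/
def krawtchoukPoly (n q i : ℕ) : ℝ[X] :=
  ∑ j ∈ range (i + 1), C ((-1) ^ j * ((q : ℝ) - 1) ^ (i - j) * (j ! : ℝ)⁻¹ * ((i - j)! : ℝ)⁻¹) *
    (descPochhammer ℝ j * (descPochhammer ℝ (i - j)).comp (C (n : ℝ) - X))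

lemma natDegree_krawtchoukPoly_le (n q i : ℕ) : (krawtchoukPoly n q i).natDegree ≤ i := by
  refine natDegree_sum_le_of_forall_le _ _ fun j hj => ?_
  refine (natDegree_C_mul_le _ _).trans (natDegree_mul_le.trans ?_)
  have hlin : (C (n : ℝ) - X).natDegree ≤ 1 := by compute_degree
  rw [natDegree_comp, descPochhammer_natDegree, descPochhammer_natDegree]
  calc j + (i - j) * (C (n : ℝ) - X).natDegree ≤ j + (i - j) * 1 := by gcongr
    _ = i := by rw [mul_one, Nat.add_sub_cancel' (mem_range_succ_iff.1 hj)]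

lemma choose_eq_descPochhammer_eval (z : ℝ) (j : ℕ) :
    Ring.choose z j = (j ! : ℝ)⁻¹ * (descPochhammer ℝ j).eval z := by
  rw [Ring.choose_eq_smul, descPochhammer_smeval_eq_ascPochhammer, ascPochhammer_smeval_eq_eval,
    descPochhammer_eval_eq_ascPochhammer, smul_eq_mul]

lemma eval_krawtchoukPoly (n q i : ℕ) (z : ℝ) :
    (krawtchoukPoly n q i).eval z = krawtchouk n q i z := by
  rw [krawtchoukPoly, eval_finsetSum, krawtchouk]
  refine sum_congr rfl fun j _ => ?_
  rw [choose_eq_descPochhammer_eval, choose_eq_descPochhammer_eval]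
  simp only [eval_mul, eval_C, eval_comp, eval_sub, eval_X]
  ring

lemma sum_choose_mul_choose_mul_genPoly (n q j : ℕ) :
    ∑ z ∈ range (n + 1), C ((n.choose z : ℝ) * z.choose j * ((q : ℝ) - 1) ^ z) * genPoly n q z =
      C ((n.choose j : ℝ) * ((q : ℝ) - 1) ^ j * (q : ℝ) ^ (n - j)) * (1 + C (-1) * X) ^ j := by
  have hsum : C ((q : ℝ) - 1) * (1 + C (-1) * X) + (1 + C ((q : ℝ) - 1) * X) = C (q : ℝ) := by
    simp only [C_sub, C_1, C_neg]
    ring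
  have hbinom := sum_choose_mul_choose_mul_pow n j (C ((q : ℝ) - 1) * (1 + C (-1) * X))
    (1 + C ((q : ℝ) - 1) * X)
  rw [hsum] at hbinom
  simp only [genPoly, C_mul, C_pow, map_natCast, mul_pow, mul_assoc] at hbinom ⊢
  simpa only [mul_comm, mul_left_comm, mul_assoc] using hbinom

lemma binomialMean_krawtchoukPoly_mul_descPochhammer (n q : ℕ) {i j : ℕ} (hj : j < i) :
    binomialMean n q (krawtchoukPoly n q i * descPochhammer ℝ j) = 0 := by
  have hcoeff := congrArg (fun p : ℝ[X] => p.coeff i) (sum_choose_mul_choose_mul_genPoly n q j)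
  simp only [finsetSum_coeff, coeff_C_mul, coeff_one_add_C_mul_X_pow, Nat.choose_eq_zero_of_lt hj,
    Nat.cast_zero, mul_zero] at hcoeff
  rw [binomialMean_apply]
  refine mul_eq_zero_of_right _ ?_
  rw [← mul_zero (j ! : ℝ), ← hcoeff, mul_sum]
  refine sum_congr rfl fun z hz => ?_
  rw [eval_mul, eval_krawtchoukPoly, krawtchouk_natCast q i (mem_range_succ_iff.1 hz),
    descPochhammer_eval_natCast]
  ring

theorem binomialMean_krawtchoukPoly_mul (n q : ℕ) {i : ℕ} {f : ℝ[X]} (hf : f.degree < i) :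
    binomialMean n q (krawtchoukPoly n q i * f) = 0 :=
  map_eq_zero_of_descPochhammer
    (Φ := binomialMean n q ∘ₗ LinearMap.mulLeft ℝ (krawtchoukPoly n q i))
    (fun _ hj => binomialMean_krawtchoukPoly_mul_descPochhammer n q hj) hf

/-- The reproducing kernel at `0` of `binomialMean n q` on the polynomials of degree at most `m`. -/
def krawtchoukKernel (n q m : ℕ) : ℝ[X] := ∑ i ∈ range (m + 1), krawtchoukPoly n q i

lemma degree_krawtchoukKernel_lt (n q m : ℕ) : (krawtchoukKernel n q m).degree < (m + 1 : ℕ) := by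
  rw [degree_lt_iff_coeff_zero]
  intro j hj
  rw [krawtchoukKernel, finsetSum_coeff]
  refine sum_eq_zero fun i hi => coeff_eq_zero_of_natDegree_lt ?_
  exact (natDegree_krawtchoukPoly_le n q i).trans_lt ((mem_range.1 hi).trans_le hj)

lemma krawtchouk_zero (n q i : ℕ) : krawtchouk n q i 0 = n.choose i * ((q : ℝ) - 1) ^ i := by
  have hcoeff := krawtchouk_natCast q i (Nat.zero_le n)
  rw [Nat.cast_zero] at hcoeff
  rw [hcoeff, genPoly, pow_zero, one_mul, coeff_one_add_C_mul_X_pow, Nat.sub_zero, mul_comm]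

lemma eval_zero_krawtchoukKernel (n q m : ℕ) :
    (krawtchoukKernel n q m).eval 0 = ∑ i ∈ range (m + 1), n.choose i * ((q : ℝ) - 1) ^ i := by
  simp only [krawtchoukKernel, eval_finsetSum, eval_krawtchoukPoly, krawtchouk_zero]

lemma eval_krawtchoukKernel_self (q : ℕ) {z : ℕ} (hz : z ≤ n) :
    (krawtchoukKernel n q n).eval (z : ℝ) = if z = 0 then (q : ℝ) ^ n else 0 := by
  have hgen := eval_genPoly q hz 1
  simp only [one_pow, mul_one] at hgen
  simp only [krawtchoukKernel, eval_finsetSum, eval_krawtchoukPoly]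
  rw [← hgen]
  split_ifs with hz0
  · simp [hz0, genPoly]
  · simp [hz0, genPoly]

theorem binomialMean_krawtchoukKernel_mul (hq : 0 < q) {m : ℕ} (hm : m ≤ n) {f : ℝ[X]}
    (hf : f.degree < (m + 1 : ℕ)) :
    binomialMean n q (krawtchoukKernel n q m * f) = f.eval 0 := by
  have hextend : binomialMean n q (krawtchoukKernel n q m * f) =
      binomialMean n q (krawtchoukKernel n q n * f) := by
    simp only [krawtchoukKernel, sum_mul, map_sum]
    refine sum_subset (range_mono (by omega)) fun i _ hi => ?_
    rw [mem_range, not_lt] at hi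
    exact binomialMean_krawtchoukPoly_mul n q (hf.trans_le (by exact_mod_cast hi))
  rw [hextend, binomialMean_apply, sum_eq_single_of_mem 0 (by simp) fun z hz hz0 => by
    rw [eval_mul, eval_krawtchoukKernel_self q (mem_range_succ_iff.1 hz), if_neg hz0, zero_mul,
      mul_zero]]
  rw [eval_mul, eval_krawtchoukKernel_self q (Nat.zero_le n)]
  simp [hq.ne']

lemma sum_choose_mul_pow_pos (n : ℕ) {r : ℝ} (hr : 0 ≤ r) (m : ℕ) :
    0 < ∑ i ∈ range (m + 1), n.choose i * r ^ i := by
  rw [sum_range_succ', Nat.choose_zero_right, pow_zero]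
  positivity

/-- Cauchy–Schwarz for `f` and the reproducing kernel `K`: the mean of `(K(0) f - f(0) K)²` is
nonnegative. -/
theorem sq_eval_zero_le (hq : 0 < q) {m : ℕ} (hm : m ≤ n) {f : ℝ[X]}
    (hf : f.degree < (m + 1 : ℕ)) :
    f.eval 0 ^ 2 ≤
      (∑ i ∈ range (m + 1), n.choose i * ((q : ℝ) - 1) ^ i) * binomialMean n q (f ^ 2) := by
  rw [← eval_zero_krawtchoukKernel]
  set K := krawtchoukKernel n q m
  have hK_pos : 0 < K.eval 0 := by
    rw [eval_zero_krawtchoukKernel]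
    exact sum_choose_mul_pow_pos n (sub_nonneg.2 (by exact_mod_cast hq)) m
  have hKf : binomialMean n q (K * f) = f.eval 0 := binomialMean_krawtchoukKernel_mul hq hm hf
  have hKK : binomialMean n q (K ^ 2) = K.eval 0 := by
    rw [pow_two]
    exact binomialMean_krawtchoukKernel_mul hq hm (degree_krawtchoukKernel_lt n q m)
  let g : ℝ[X] := K.eval 0 • f - f.eval 0 • K
  have hexpand : g ^ 2 = (K.eval 0 ^ 2) • f ^ 2 - (2 * K.eval 0 * f.eval 0) • (K * f) +
      (f.eval 0 ^ 2) • K ^ 2 := by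
    simp only [g, smul_eq_C_mul, C_mul, C_pow, map_ofNat]
    ring
  have hgg : binomialMean n q (g ^ 2) =
      K.eval 0 * (K.eval 0 * binomialMean n q (f ^ 2) - f.eval 0 ^ 2) := by
    rw [hexpand, map_add, map_sub, map_smul, map_smul, map_smul, hKf, hKK]
    simp only [smul_eq_mul]
    ring
  have hnonneg : 0 ≤ binomialMean n q (g ^ 2) :=
    binomialMean_nonneg hq fun z _ => by rw [eval_pow]; exact sq_nonneg _
  rw [hgg] at hnonneg
  exact sub_nonneg.1 (nonneg_of_mul_nonneg_right hnonneg hK_pos)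

end BinomialMean

section InnerProducts

variable {n q : ℕ}

/-- The affine substitution `z ↦ 1 - 2 z / n` that turns distances into inner products. -/
def distToIp (n : ℕ) : ℝ[X] := C 1 - C (2 / (n : ℝ)) * X

lemma eval_distToIp (n : ℕ) (z : ℝ) : (distToIp n).eval z = 1 - 2 * z / n := by
  rw [distToIp, eval_sub, eval_mul, eval_C, eval_C, eval_X, div_mul_eq_mul_div]

lemma ip_eq_eval_distToIp (x y : HSpace n q) : ip x y = (distToIp n).eval (hammingDist x y : ℝ) :=
  (eval_distToIp n _).symm

lemma natDegree_distToIp_le (n : ℕ) : (distToIp n).natDegree ≤ 1 := by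
  rw [distToIp]
  compute_degree

lemma degree_comp_lt {R : Type*} [Semiring R] {m : ℕ} {f r : R[X]} (hf : f.degree < m)
    (hr : r.natDegree ≤ 1) : (f.comp r).degree < m := by
  rcases eq_or_ne f 0 with rfl | hf0
  · rwa [zero_comp]
  · rw [degree_eq_natDegree hf0, Nat.cast_lt] at hf
    refine degree_le_natDegree.trans_lt (Nat.cast_lt.2 (lt_of_le_of_lt ?_ hf))
    calc (f.comp r).natDegree ≤ f.natDegree * r.natDegree := natDegree_comp_le
      _ ≤ f.natDegree * 1 := by gcongr
      _ = f.natDegree := mul_one _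

lemma eval_distToIp_mem_innerProducts (hn : 0 < n) {z : ℕ} (hz : z ≤ n) :
    (distToIp n).eval (z : ℝ) ∈ innerProducts n := by
  refine ⟨n - z, Nat.sub_le n z, ?_⟩
  rw [eval_distToIp, Nat.cast_sub hz]
  field_simp
  ring

lemma normKrawtchouk_eval_distToIp (hn : 0 < n) (q i : ℕ) (z : ℝ) :
    normKrawtchouk n q i ((distToIp n).eval z) =
      krawtchouk n q i z / (((q : ℝ) - 1) ^ i * n.choose i) := by
  have hz : (n : ℝ) * (1 - (1 - 2 * z / n)) / 2 = z := by
    field_simp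
    ring
  rw [normKrawtchouk, eval_distToIp, hz]

lemma krawtchoukCoeff_zero (hn : 0 < n) (hq : 2 ≤ q) (f : ℝ[X]) :
    krawtchoukCoeff n q f 0 = binomialMean n q (f.comp (distToIp n)) := by
  have hexp := (isKrawtchoukExpansion_iff hn hq f _).2 rfl
  set c := krawtchoukCoeff n q f
  have hterm : ∀ z ∈ range (n + 1), (n.choose z : ℝ) * ((q : ℝ) - 1) ^ z *
      (f.comp (distToIp n)).eval (z : ℝ) = ∑ i, c i / (((q : ℝ) - 1) ^ (i : ℕ) * n.choose i) *
        (krawtchouk n q i z * krawtchouk n q z (0 : ℕ)) := fun z hz => by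
    rw [eval_comp, hexp _ (eval_distToIp_mem_innerProducts hn (mem_range_succ_iff.1 hz)), mul_sum,
      Nat.cast_zero, krawtchouk_zero]
    refine sum_congr rfl fun i _ => ?_
    rw [normKrawtchouk_eval_distToIp hn]
    ring
  rw [binomialMean_apply, sum_congr rfl hterm, sum_comm]
  simp only [← mul_sum, sum_krawtchouk_mul hq _ (Nat.zero_le n)]
  rw [sum_eq_single_of_mem 0 (mem_univ _) fun i _ hi => by
    rw [if_neg (Fin.val_ne_zero_iff.2 hi), mul_zero]]
  have : q ≠ 0 := by omega
  simp [field]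

end InnerProducts

section Designs

open scoped Nat

variable {n q τ : ℕ} {D : Finset (HSpace n q)}

lemma hammingDist_le_length (x y : HSpace n q) : hammingDist x y ≤ n := by
  simpa using hammingDist_le_card_fintype (x := x) (y := y)

lemma length_sub_hammingDist (x y : HSpace n q) : n - hammingDist x y = #{i | y i = x i} := by
  have hcard := card_filter_add_card_filter_not (s := (univ : Finset (Fin n))) fun i => y i = x i
  rw [card_univ, Fintype.card_fin] at hcard
  rw [hammingDist_comm, hammingDist]
  simp only [ne_eq]
  omega

lemma card_filter_agree_eq_sum (D : Finset (HSpace n q)) {S : Finset (Fin n)} {i : Fin n}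
    (hi : i ∉ S) (x : HSpace n q) :
    #{y ∈ D | ∀ l ∈ S, y l = x l} =
      ∑ a, #{y ∈ D | ∀ l ∈ insert i S, y l = Function.update x i a l} := by
  rw [card_eq_sum_card_fiberwise (f := fun y => y i) (t := univ) (by simp)]
  refine sum_congr rfl fun a _ => congrArg card ?_
  have hupdate : ∀ y : HSpace n q, (∀ l ∈ S, y l = Function.update x i a l) ↔ ∀ l ∈ S, y l = x l :=
    fun y => forall₂_congr fun l hl => by
      rw [Function.update_of_ne (ne_of_mem_of_not_mem hl hi)]
  ext y
  simp only [mem_filter, mem_insert, forall_eq_or_imp, Function.update_self, hupdate]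
  tauto

lemma IsDesign.card_filter_agree_of_card_eq (hD : IsDesign τ D) {S : Finset (Fin n)} (hS : #S = τ)
    (x : HSpace n q) : #{y ∈ D | ∀ i ∈ S, y i = x i} * q ^ τ = #D := by
  obtain ⟨lam, -, hcard, hlam⟩ := hD
  have hagree : ∀ y : HSpace n q, (∀ i ∈ S, y i = x i) ↔
      ∀ j, y ((S.orderEmbOfFin hS).toEmbedding j) = x (S.orderEmbOfFin hS j) := by
    refine fun y => ⟨fun h j => h _ (S.orderEmbOfFin_mem hS j), fun h i hi => ?_⟩
    obtain ⟨j, rfl⟩ : i ∈ Set.range (S.orderEmbOfFin hS) := by simpa using hi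
    exact h j
  simp only [hagree]
  rw [hlam (S.orderEmbOfFin hS).toEmbedding fun j => x (S.orderEmbOfFin hS j), hcard]

lemma IsDesign.card_filter_agree (hD : IsDesign τ D) (hτ : τ ≤ n) {j : ℕ} (hj : j ≤ τ) :
    ∀ S : Finset (Fin n), #S = j → ∀ x : HSpace n q,
      #{y ∈ D | ∀ i ∈ S, y i = x i} * q ^ j = #D := by
  induction hj using Nat.decreasingInduction with
  | self => exact fun S hS => hD.card_filter_agree_of_card_eq hS
  | of_succ j hj ih =>
    intro S hS x
    obtain ⟨i, hi⟩ : ∃ i, i ∉ S := by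
      by_contra! hall
      rw [eq_univ_iff_forall.2 hall, card_univ, Fintype.card_fin] at hS
      omega
    refine Nat.eq_of_mul_eq_mul_right (x i).pos ?_
    calc #{y ∈ D | ∀ l ∈ S, y l = x l} * q ^ j * q
        = ∑ a : Fin q,
            #{y ∈ D | ∀ l ∈ insert i S, y l = Function.update x i a l} * q ^ (j + 1) := by
          rw [mul_assoc, ← pow_succ, card_filter_agree_eq_sum D hi, sum_mul]
      _ = ∑ _a : Fin q, #D :=
          sum_congr rfl fun a _ => ih _ (by rw [card_insert_of_notMem hi, hS]) _
      _ = #D * q := by rw [sum_const, card_univ, Fintype.card_fin, smul_eq_mul, mul_comm]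

lemma IsDesign.le_length (hq : 1 < q) (hD : IsDesign τ D) : τ ≤ n := by
  obtain ⟨lam, hlam, hcard, -⟩ := hD
  refine (Nat.pow_le_pow_iff_right hq).1 ?_
  calc q ^ τ ≤ lam * q ^ τ := Nat.le_mul_of_pos_left _ hlam
    _ = #D := hcard.symm
    _ ≤ q ^ n := by simpa using card_le_univ D

/-- Double counting of the pairs of a codeword `y` and a set of `j` coordinates where `x` and `y`
agree. -/
lemma IsDesign.sum_choose_agreement (hq : 1 < q) (hD : IsDesign τ D) {j : ℕ} (hj : j ≤ τ)
    (x : HSpace n q) :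
    (∑ y ∈ D, (n - hammingDist x y).choose j) * q ^ j = n.choose j * #D := by
  have hchoose : ∀ y, (n - hammingDist x y).choose j =
      ∑ S ∈ powersetCard j (univ : Finset (Fin n)), if ∀ i ∈ S, y i = x i then 1 else 0 := by
    intro y
    rw [length_sub_hammingDist, ← card_powersetCard, ← card_filter]
    congr 1
    ext S
    simp [mem_powersetCard, subset_iff, and_comm]
  simp only [hchoose]
  rw [sum_comm, sum_mul]
  simp only [← card_filter]
  rw [sum_congr rfl fun S hS => hD.card_filter_agree (hD.le_length hq) hj S
    (mem_powersetCard.1 hS).2 x]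
  simp

lemma binomialMean_descPochhammer_comp (hq : 0 < q) (n j : ℕ) :
    binomialMean n q ((descPochhammer ℝ j).comp (C (n : ℝ) - X)) * q ^ j = j ! * n.choose j := by
  have hq0 : (q : ℝ) ≠ 0 := by positivity
  have heval : ∀ z ∈ range (n + 1), (n.choose z : ℝ) * ((q : ℝ) - 1) ^ z *
      ((descPochhammer ℝ j).comp (C (n : ℝ) - X)).eval (z : ℝ) =
        j ! * ((n.choose (n - z) : ℝ) * (n - z).choose j *
          (1 ^ (n - z) * ((q : ℝ) - 1) ^ (n - (n - z)))) := fun z hz => by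
    have hz : z ≤ n := mem_range_succ_iff.1 hz
    rw [eval_comp, eval_sub, eval_C, eval_X, ← Nat.cast_sub hz, descPochhammer_eval_natCast,
      Nat.choose_symm hz, Nat.sub_sub_self hz]
    ring
  rw [binomialMean_apply, sum_congr rfl heval, ← mul_sum,
    sum_flip fun w => (n.choose w : ℝ) * w.choose j * (1 ^ w * ((q : ℝ) - 1) ^ (n - w)),
    sum_choose_mul_choose_mul_pow, one_pow, one_mul, add_sub_cancel]
  rcases le_or_gt j n with hj | hj
  · rw [← Nat.add_sub_cancel' hj, pow_add, Nat.add_sub_cancel_left]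
    field_simp
  · simp [Nat.choose_eq_zero_of_lt hj]

theorem IsDesign.sum_eval_agreement (hq : 1 < q) (hD : IsDesign τ D) {f : ℝ[X]}
    (hf : f.degree < (τ + 1 : ℕ)) (x : HSpace n q) :
    ∑ y ∈ D, f.eval ((n : ℝ) - hammingDist x y) =
      #D * binomialMean n q (f.comp (C (n : ℝ) - X)) := by
  let Φ : ℝ[X] →ₗ[ℝ] ℝ := ∑ y ∈ D, leval ((n : ℝ) - hammingDist x y) -
    (#D : ℝ) • binomialMean n q ∘ₗ (aeval (C (n : ℝ) - X)).toLinearMap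
  have hΦ : ∀ g, Φ g = ∑ y ∈ D, g.eval ((n : ℝ) - hammingDist x y) -
      #D * binomialMean n q (g.comp (C (n : ℝ) - X)) := fun g => by
    simp [Φ, comp_eq_aeval, leval_apply]
  rw [← sub_eq_zero, ← hΦ]
  refine map_eq_zero_of_descPochhammer (fun j hj => ?_) hf
  have hmoment : ∑ y ∈ D, (descPochhammer ℝ j).eval ((n : ℝ) - hammingDist x y) =
      j ! * (∑ y ∈ D, (n - hammingDist x y).choose j : ℕ) := by
    rw [Nat.cast_sum, mul_sum]
    refine sum_congr rfl fun y _ => ?_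
    rw [← Nat.cast_sub (hammingDist_le_length x y), descPochhammer_eval_natCast]
  have hcount : ((∑ y ∈ D, (n - hammingDist x y).choose j : ℕ) : ℝ) * q ^ j = n.choose j * #D := by
    exact_mod_cast hD.sum_choose_agreement hq (Nat.lt_succ_iff.1 hj) x
  have hq0 : (q : ℝ) ^ j ≠ 0 := by positivity
  refine mul_right_cancel₀ hq0 ?_
  rw [hΦ, hmoment, zero_mul, sub_mul, mul_assoc, hcount, mul_assoc,
    binomialMean_descPochhammer_comp (by omega)]
  ring

theorem IsDesign.sum_eval_hammingDist (hq : 1 < q) (hD : IsDesign τ D) {f : ℝ[X]}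
    (hf : f.degree < (τ + 1 : ℕ)) (x : HSpace n q) :
    ∑ y ∈ D, f.eval (hammingDist x y : ℝ) = #D * binomialMean n q f := by
  have hreflect : (f.comp (C (n : ℝ) - X)).comp (C (n : ℝ) - X) = f := by
    rw [comp_assoc, sub_comp, C_comp, X_comp, sub_sub_cancel, comp_X]
  have hlin : (C (n : ℝ) - X).natDegree ≤ 1 := by compute_degree
  have hsum := hD.sum_eval_agreement hq (degree_comp_lt hf hlin) x
  rw [hreflect] at hsum
  simpa only [eval_comp, eval_sub, eval_C, eval_X, sub_sub_cancel] using hsum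

theorem IsDesign.sum_eval_ip (hn : 0 < n) (hq : 2 ≤ q) (hD : IsDesign τ D) {f : ℝ[X]}
    (hf : f.degree < (τ + 1 : ℕ)) (x : HSpace n q) :
    ∑ y ∈ D, f.eval (ip x y) = #D * krawtchoukCoeff n q f 0 := by
  rw [krawtchoukCoeff_zero hn hq,
    ← hD.sum_eval_hammingDist hq (degree_comp_lt hf (natDegree_distToIp_le n)) x]
  simp only [eval_comp, ip_eq_eval_distToIp]

lemma ip_self (x : HSpace n q) : ip x x = 1 := by
  rw [ip, hammingDist_self, Nat.cast_zero, mul_zero, zero_div, sub_zero]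

lemma ip_mem_Ico {x y : HSpace n q} (hxy : x ≠ y) : ip x y ∈ Set.Ico (-1 : ℝ) 1 := by
  have hd_pos : 0 < hammingDist x y := hammingDist_pos.2 hxy
  have hd_le := hammingDist_le_length x y
  have hn : (0 : ℝ) < n := by exact_mod_cast hd_pos.trans_le hd_le
  have hle : 2 * (hammingDist x y : ℝ) / n ≤ 2 := by
    rw [div_le_iff₀ hn]
    exact_mod_cast Nat.mul_le_mul_left 2 hd_le
  have hpos : 0 < 2 * (hammingDist x y : ℝ) / n := by positivity
  rw [ip]
  constructor <;> linarith

lemma IsDesign.le_sum_ip (hn : 0 < n) (hq : 2 ≤ q) (hD : IsDesign τ D) {f : ℝ[X]}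
    (hf : f.degree < (τ + 1 : ℕ)) {h : ℝ → ℝ} (hfh : ∀ t ∈ Set.Ico (-1 : ℝ) 1, f.eval t ≤ h t)
    {x : HSpace n q} (hx : x ∈ D) :
    #D * krawtchoukCoeff n q f 0 - f.eval 1 ≤ ∑ y ∈ D with x ≠ y, h (ip x y) := by
  calc #D * krawtchoukCoeff n q f 0 - f.eval 1
      = ∑ y ∈ D with x ≠ y, f.eval (ip x y) := by
        rw [← hD.sum_eval_ip hn hq hf x, filter_ne, ← sum_erase_add D _ hx, ip_self,
          add_sub_cancel_right]
    _ ≤ ∑ y ∈ D with x ≠ y, h (ip x y) :=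
        sum_le_sum fun y hy => hfh _ (ip_mem_Ico (mem_filter.1 hy).2)

theorem IsDesign.le_energy (hn : 0 < n) (hq : 2 ≤ q) (hD : IsDesign τ D) {f : ℝ[X]}
    (hf : f.degree < (τ + 1 : ℕ)) {h : ℝ → ℝ}
    (hfh : ∀ t ∈ Set.Ico (-1 : ℝ) 1, f.eval t ≤ h t) :
    krawtchoukCoeff n q f 0 * #D - f.eval 1 ≤ energy h D := by
  have hcard_pos : (0 : ℝ) < #D := by
    obtain ⟨lam, hlam, hcard, -⟩ := hD
    rw [Nat.cast_pos, hcard]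
    positivity
  rw [energy, one_div, inv_mul_eq_div, le_div_iff₀ hcard_pos, mul_comm _ (#D : ℝ),
    mul_comm _ (#D : ℝ), ← nsmul_eq_mul (#D) (_ - _), ← sum_const]
  exact sum_le_sum fun x hx => hD.le_sum_ip hn hq hf hfh hx

end Designs

section RaoBound

variable {n q : ℕ}

lemma raoBound_even (n q k : ℕ) :
    raoBound n q (2 * k) = ∑ i ∈ range (k + 1), n.choose i * (q - 1) ^ i := by
  rw [raoBound, if_pos (even_two_mul k), Nat.mul_div_cancel_left k two_pos]

lemma raoBound_odd (n q k : ℕ) :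
    raoBound n q (2 * k + 1) = q * ∑ i ∈ range (k + 1), (n - 1).choose i * (q - 1) ^ i := by
  rw [raoBound, if_neg (Nat.not_even_two_mul_add_one k), add_assoc, ← mul_add_one,
    Nat.mul_div_cancel_left (k + 1) two_pos]

lemma sum_range_choose_mul_pow (hq : 0 < q) {N m : ℕ} (hm : N < m) :
    ∑ i ∈ range m, N.choose i * (q - 1) ^ i = q ^ N := by
  have hadd : q ^ N = ∑ i ∈ range (N + 1), N.choose i * (q - 1) ^ i := by
    obtain ⟨r, rfl⟩ : ∃ r, q = r + 1 := ⟨q - 1, by omega⟩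
    rw [add_pow, Nat.add_sub_cancel]
    exact sum_congr rfl fun i _ => by rw [one_pow, mul_one, mul_comm, Nat.cast_id]
  rw [hadd]
  refine (sum_subset (range_mono hm) fun i _ hi => ?_).symm
  rw [mem_range, not_lt] at hi
  rw [Nat.choose_eq_zero_of_lt hi, zero_mul]

lemma raoBound_eq_pow (hn : 0 < n) (hq : 0 < q) {τ : ℕ} (hτ : 2 * n ≤ τ + 1) :
    raoBound n q τ = q ^ n := by
  obtain ⟨k, rfl | rfl⟩ := Nat.even_or_odd' τ
  · rw [raoBound_even, sum_range_choose_mul_pow hq (by omega)]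
  · rw [raoBound_odd, sum_range_choose_mul_pow hq (by omega), mul_pow_sub_one hn.ne']

lemma lt_two_mul_of_raoBound_lt (hn : 0 < n) (hq : 0 < q) {τ : ℕ}
    (hτ : raoBound n q τ < raoBound n q (τ + 1)) : τ < 2 * n := by
  by_contra! hle
  rw [raoBound_eq_pow hn hq (by omega), raoBound_eq_pow hn hq (by omega)] at hτ
  exact hτ.false

lemma cast_raoBound_even (hq : 0 < q) (n k : ℕ) :
    (raoBound n q (2 * k) : ℝ) = ∑ i ∈ range (k + 1), n.choose i * ((q : ℝ) - 1) ^ i := by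
  simp [raoBound_even, Nat.cast_pred hq]

lemma cast_raoBound_odd (hq : 0 < q) (n k : ℕ) : (raoBound n q (2 * k + 1) : ℝ) =
    q * ∑ i ∈ range (k + 1), (n - 1).choose i * ((q : ℝ) - 1) ^ i := by
  simp [raoBound_odd, Nat.cast_pred hq]

end RaoBound

section Positivity

variable {n q M k : ℕ}

lemma binomialMean_mul_sq_pos (hq : 1 < q) {g f : ℝ[X]} (hg : ∀ z ≤ n, 0 ≤ g.eval (z : ℝ))
    {Z : Finset ℕ} (hZ : ∀ z ∈ Z, z ≤ n ∧ g.eval (z : ℝ) ≠ 0) (hf0 : f ≠ 0)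
    (hf : f.degree < (#Z : ℕ)) : 0 < binomialMean n q (g * f ^ 2) := by
  obtain ⟨z, hz, hfz⟩ : ∃ z ∈ Z, f.eval (z : ℝ) ≠ 0 := by
    by_contra! hzero
    exact hf0 (eq_zero_of_degree_lt_of_eval_index_eq_zero (s := Z) (v := ((↑) : ℕ → ℝ))
      Nat.cast_injective.injOn hf hzero)
  refine binomialMean_pos hq (fun w hw => ?_) (hZ z hz).1 ?_
  · rw [eval_mul, eval_pow]
    exact mul_nonneg (hg w hw) (sq_nonneg _)
  · rw [eval_mul, eval_pow]
    exact mul_ne_zero (hZ z hz).2 (pow_ne_zero 2 hfz)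

lemma sq_eval_zero_lt (hq : 1 < q) {m : ℕ} (hm : m ≤ n) {R : ℝ}
    (hR : ∑ i ∈ range (m + 1), n.choose i * ((q : ℝ) - 1) ^ i < R) {f : ℝ[X]} (hf0 : f ≠ 0)
    (hf : f.degree < (m + 1 : ℕ)) : f.eval 0 ^ 2 < R * binomialMean n q (f ^ 2) := by
  have hpos : 0 < binomialMean n q (1 * f ^ 2) :=
    binomialMean_mul_sq_pos (Z := range (m + 1)) hq (by simp)
      (fun z hz => ⟨(mem_range_succ_iff.1 hz).trans hm, by simp⟩) hf0 (by rwa [card_range])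
  rw [one_mul] at hpos
  exact (sq_eval_zero_le (zero_lt_one.trans hq) hm hf).trans_lt (mul_lt_mul_of_pos_right hR hpos)

/-- A length-biased binomial distribution is a binomial distribution with one trial less. -/
lemma binomialMean_succ_sub_X_mul (hq : 0 < q) (N : ℕ) (g : ℝ[X]) :
    binomialMean (N + 1) q ((C ((N + 1 : ℕ) : ℝ) - X) * g) =
      (N + 1 : ℕ) / q * binomialMean N q g := by
  have hq0 : (q : ℝ) ≠ 0 := by positivity
  have hchoose : ∀ z ∈ range (N + 1), ((N + 1).choose z : ℝ) * ((N + 1 : ℕ) - z) =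
      N.choose z * (N + 1 : ℕ) := fun z hz => by
    rw [← Nat.cast_sub (mem_range.1 hz).le]
    exact_mod_cast (Nat.choose_mul_succ_eq N z).symm
  rw [binomialMean_apply, binomialMean_apply, sum_range_succ]
  simp only [eval_mul, eval_sub, eval_C, eval_X, sub_self, zero_mul, mul_zero, add_zero]
  rw [mul_sum, mul_sum, mul_sum]
  refine sum_congr rfl fun z hz => ?_
  calc ((q : ℝ) ^ (N + 1))⁻¹ * (((N + 1).choose z : ℝ) * ((q : ℝ) - 1) ^ z *
        (((N + 1 : ℕ) - z) * g.eval (z : ℝ)))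
      = ((q : ℝ) ^ (N + 1))⁻¹ * ((((N + 1).choose z : ℝ) * ((N + 1 : ℕ) - z)) *
        ((q : ℝ) - 1) ^ z * g.eval (z : ℝ)) := by ring
    _ = _ := by
      rw [hchoose z hz, pow_succ]
      field_simp

/-- The functional `f ↦ f_0 - f(1) / M`. -/
def quadratureFunctional (n q M : ℕ) : ℝ[X] →ₗ[ℝ] ℝ :=
  binomialMean n q ∘ₗ (aeval (distToIp n)).toLinearMap - (M : ℝ)⁻¹ • leval 1

lemma quadratureFunctional_apply (n q M : ℕ) (f : ℝ[X]) :
    quadratureFunctional n q M f = binomialMean n q (f.comp (distToIp n)) - f.eval 1 / M := by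
  simp [quadratureFunctional, comp_eq_aeval, leval_apply, div_eq_inv_mul]

lemma comp_distToIp_ne_zero (hn : 0 < n) {p : ℝ[X]} (hp : p ≠ 0) : p.comp (distToIp n) ≠ 0 := by
  have hcoeff : (distToIp n).coeff 1 ≠ 0 := by simp [distToIp, coeff_one, hn.ne']
  rw [Ne, comp_eq_zero_iff]
  rintro (h | ⟨-, h⟩)
  · exact hp h
  · rw [h, coeff_C_succ] at hcoeff
    exact hcoeff rfl

lemma eval_zero_comp_distToIp (n : ℕ) (p : ℝ[X]) : (p.comp (distToIp n)).eval 0 = p.eval 1 := by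
  rw [eval_comp, eval_distToIp, mul_zero, zero_div, sub_zero]

theorem isPosDefBelow_quadratureFunctional (hq : 1 < q) (hn : 0 < n) (hk : k ≤ n)
    (hM : raoBound n q (2 * k) < M) : IsPosDefBelow (quadratureFunctional n q M) (k + 1) := by
  intro p hp hdeg
  have hM0 : (0 : ℝ) < M := by exact_mod_cast hM.pos
  have hR : (raoBound n q (2 * k) : ℝ) < M := by exact_mod_cast hM
  rw [cast_raoBound_even (by omega)] at hR
  have hlt := sq_eval_zero_lt hq hk hR (comp_distToIp_ne_zero hn hp)
    (degree_comp_lt hdeg (natDegree_distToIp_le n))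
  rw [eval_zero_comp_distToIp, ← pow_comp] at hlt
  rw [quadratureFunctional_apply, eval_pow, sub_pos, div_lt_iff₀' hM0]
  exact hlt

lemma quadratureFunctional_X_sub_C_neg_one_mul (hq : 0 < q) (N M : ℕ) (f : ℝ[X]) :
    quadratureFunctional (N + 1) q M ((X - C (-1)) * f) =
      2 * (binomialMean N q (f.comp (distToIp (N + 1))) / q - f.eval 1 / M) := by
  have hN : ((N + 1 : ℕ) : ℝ) ≠ 0 := by positivity
  have hcomp : ((X - C (-1) : ℝ[X]) * f).comp (distToIp (N + 1)) =
      (2 / ((N + 1 : ℕ) : ℝ)) • ((C ((N + 1 : ℕ) : ℝ) - X) * f.comp (distToIp (N + 1))) := by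
    refine Polynomial.funext fun z => ?_
    simp only [eval_comp, eval_mul, eval_sub, eval_X, eval_C, eval_smul, eval_distToIp, smul_eq_mul]
    field_simp
    ring
  rw [quadratureFunctional_apply, hcomp, map_smul, binomialMean_succ_sub_X_mul hq, smul_eq_mul]
  simp only [eval_mul, eval_sub, eval_X, eval_C]
  field_simp
  ring

theorem isPosDefBelow_weighted_add_one (hq : 1 < q) (hk : k < n)
    (hM : raoBound n q (2 * k + 1) < M) :
    IsPosDefBelow (weighted (X - C (-1)) (quadratureFunctional n q M)) (k + 1) := by
  intro p hp hdeg
  obtain ⟨N, rfl⟩ : ∃ N, n = N + 1 := ⟨n - 1, by omega⟩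
  have hq0 : (0 : ℝ) < q := by positivity
  have hM0 : (0 : ℝ) < M := by exact_mod_cast hM.pos
  have hR : (raoBound (N + 1) q (2 * k + 1) : ℝ) < M := by exact_mod_cast hM
  rw [cast_raoBound_odd (by omega), Nat.add_sub_cancel, ← lt_div_iff₀' hq0] at hR
  have hlt := sq_eval_zero_lt hq (by omega) hR (comp_distToIp_ne_zero N.succ_pos hp)
    (degree_comp_lt hdeg (natDegree_distToIp_le _))
  rw [eval_zero_comp_distToIp, ← pow_comp] at hlt
  rw [weighted_apply, quadratureFunctional_X_sub_C_neg_one_mul (by omega), eval_pow]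
  refine mul_pos two_pos (sub_pos.2 ((div_lt_iff₀' hM0).2 ?_))
  rwa [← mul_div_right_comm, mul_div_assoc] at hlt

lemma isPosDefBelow_weighted_of_eval_one (hq : 1 < q) (hn : 0 < n) (M : ℕ) {g : ℝ[X]}
    (hg1 : g.eval 1 = 0) (hg : ∀ z ≤ n, 0 ≤ g.eval ((distToIp n).eval (z : ℝ))) {Z : Finset ℕ}
    (hZ : ∀ z ∈ Z, z ≤ n ∧ g.eval ((distToIp n).eval (z : ℝ)) ≠ 0) :
    IsPosDefBelow (weighted g (quadratureFunctional n q M)) #Z := by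
  intro p hp hdeg
  rw [weighted_apply, quadratureFunctional_apply, eval_mul, hg1, zero_mul, zero_div, sub_zero,
    mul_comp, pow_comp]
  simp only [← eval_comp] at hg hZ
  exact binomialMean_mul_sq_pos hq hg hZ (comp_distToIp_ne_zero hn hp)
    (degree_comp_lt hdeg (natDegree_distToIp_le n))

lemma isPosDefBelow_weighted_one_sub (hq : 1 < q) (hn : 0 < n) (M : ℕ) :
    IsPosDefBelow (weighted (C 1 - X) (quadratureFunctional n q M)) n := by
  have heval : ∀ z : ℕ, (C 1 - X : ℝ[X]).eval ((distToIp n).eval (z : ℝ)) = 2 * z / n := fun z => by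
    rw [eval_distToIp, eval_sub, eval_C, eval_X, sub_sub_cancel]
  convert! isPosDefBelow_weighted_of_eval_one (g := C 1 - X) (Z := Icc 1 n) hq hn M (by simp)
    (fun z _ => ?_) fun z hz => ⟨(mem_Icc.1 hz).2, ?_⟩
  · rw [Nat.card_Icc, Nat.add_sub_cancel]
  · rw [heval]
    positivity
  · have : 0 < z := (mem_Icc.1 hz).1
    rw [heval]
    positivity

lemma isPosDefBelow_weighted_add_one_mul_one_sub (hq : 1 < q) (hn : 0 < n) (M : ℕ) :
    IsPosDefBelow (weighted ((X - C (-1)) * (C 1 - X)) (quadratureFunctional n q M)) (n - 1) := by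
  have heval : ∀ z : ℕ, ((X - C (-1)) * (C 1 - X) : ℝ[X]).eval ((distToIp n).eval (z : ℝ)) =
      4 * ((n : ℝ) - z) * z / n ^ 2 := fun z => by
    rw [eval_distToIp]
    simp only [eval_mul, eval_sub, eval_C, eval_X]
    field_simp
    ring
  convert! isPosDefBelow_weighted_of_eval_one (g := (X - C (-1)) * (C 1 - X)) (Z := Ioo 0 n) hq hn M
    (by simp) (fun z hz => ?_) fun z hz => ⟨(mem_Ioo.1 hz).2.le, ?_⟩
  · rw [Nat.card_Ioo, Nat.sub_zero]
  · rw [heval, ← Nat.cast_sub hz]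
    positivity
  · obtain ⟨hz0, hzn⟩ := mem_Ioo.1 hz
    have := Nat.sub_pos_of_lt hzn
    rw [heval, ← Nat.cast_sub hzn.le]
    positivity

end Positivity

section EnergyBound

variable {n q M : ℕ}

lemma natDegree_le_iff_degree_lt_succ {R : Type*} [Semiring R] {f : R[X]} {N : ℕ} :
    f.natDegree ≤ N ↔ f.degree < (N + 1 : ℕ) := by
  simp only [natDegree_le_iff_coeff_eq_zero, degree_lt_iff_coeff_zero, Nat.succ_le_iff]

lemma quadratureFunctional_eq (hn : 0 < n) (hq : 2 ≤ q) (M : ℕ) (f : ℝ[X]) :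
    quadratureFunctional n q M f = krawtchoukCoeff n q f 0 - f.eval 1 / M := by
  rw [quadratureFunctional_apply, krawtchoukCoeff_zero hn hq]

lemma isQuadrature_quadratureFunctional_iff {ι : Type*} [Fintype ι] (hn : 0 < n) (hq : 2 ≤ q)
    {τ : ℕ} {x w : ι → ℝ} : IsQuadrature (quadratureFunctional n q M) (τ + 1) x w ↔
      ∀ f : ℝ[X], f.natDegree ≤ τ →
        krawtchoukCoeff n q f 0 = f.eval 1 / M + ∑ i, w i * f.eval (x i) := by
  simp only [IsQuadrature, quadratureFunctional_eq hn hq, sub_eq_iff_eq_add',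
    natDegree_le_iff_degree_lt_succ]

lemma isOddQuadrature_iff (hn : 0 < n) (hq : 2 ≤ q) {k : ℕ} (hk : 0 < k) {α ρ : Fin k → ℝ} :
    IsOddQuadrature n q M k α ρ ↔
      IsGaussQuadrature (quadratureFunctional n q M) (-1) 1 α ρ := by
  rw [IsOddQuadrature, IsGaussQuadrature, ← isQuadrature_quadratureFunctional_iff hn hq,
    Nat.sub_add_cancel (by omega)]

lemma isEvenQuadrature_iff (hn : 0 < n) (hq : 2 ≤ q) {k : ℕ} {β γ : Fin (k + 1) → ℝ} :
    IsEvenQuadrature n q M k β γ ↔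
      IsRadauQuadrature (quadratureFunctional n q M) (-1) 1 β γ := by
  rw [IsEvenQuadrature, IsRadauQuadrature, ← isQuadrature_quadratureFunctional_iff hn hq]

theorem existsUnique_isOddQuadrature (hq : 2 ≤ q) {k : ℕ} (hk : 0 < k) (hkn : k ≤ n)
    (hM : raoBound n q (2 * k - 1) < M) :
    ∃! p : (Fin k → ℝ) × (Fin k → ℝ), IsOddQuadrature n q M k p.1 p.2 := by
  have hn : 0 < n := by omega
  obtain ⟨j, rfl⟩ := Nat.exists_eq_add_one.2 hk
  simp only [isOddQuadrature_iff hn hq hk]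
  exact existsUnique_isGaussQuadrature (by norm_num) (isPosDefBelow_weighted_add_one hq hkn hM)
    ((isPosDefBelow_weighted_one_sub hq hn M).mono hkn)

theorem existsUnique_isEvenQuadrature (hq : 2 ≤ q) {k : ℕ} (hkn : k < n)
    (hM : raoBound n q (2 * k) < M) :
    ∃! p : (Fin (k + 1) → ℝ) × (Fin (k + 1) → ℝ), IsEvenQuadrature n q M k p.1 p.2 := by
  have hn : 0 < n := by omega
  simp only [isEvenQuadrature_iff hn hq]
  exact existsUnique_isRadauQuadrature (by norm_num)
    (isPosDefBelow_quadratureFunctional hq hn hkn.le hM)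
    ((isPosDefBelow_weighted_add_one_mul_one_sub hq hn M).mono (by omega))

variable {τ : ℕ} {ι : Type*} [Fintype ι] {x w : ι → ℝ} {h : ℝ → ℝ} {f : ℝ[X]}

lemma IsQuadrature.mul_sum_eq (hn : 0 < n) (hq : 2 ≤ q) (hM : 0 < M)
    (hquad : IsQuadrature (quadratureFunctional n q M) (τ + 1) x w) (hf : f.natDegree ≤ τ) :
    M * ∑ i, w i * f.eval (x i) = krawtchoukCoeff n q f 0 * M - f.eval 1 := by
  rw [(isQuadrature_quadratureFunctional_iff hn hq).1 hquad f hf]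
  field_simp
  ring

theorem IsQuadrature.le_minDesignEnergy (hn : 0 < n) (hq : 2 ≤ q) (hM : 0 < M)
    (hquad : IsQuadrature (quadratureFunctional n q M) (τ + 1) x w) (hf : f.natDegree ≤ τ)
    (hfh : ∀ t ∈ Set.Ico (-1 : ℝ) 1, f.eval t ≤ h t) (hfx : ∀ i, f.eval (x i) = h (x i)) :
    ((M * ∑ i, w i * h (x i) : ℝ) : EReal) ≤ minDesignEnergy n q M τ h := by
  refine le_iInf₂ fun D ⟨hcard, hD⟩ => EReal.coe_le_coe_iff.2 ?_
  simp only [← hfx]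
  rw [hquad.mul_sum_eq hn hq hM hf, ← hcard]
  exact hD.le_energy hn hq (natDegree_le_iff_degree_lt_succ.1 hf) hfh

theorem IsQuadrature.isGreatest_linearProgramValues (hn : 0 < n) (hq : 2 ≤ q) (hM : 0 < M)
    (hquad : IsQuadrature (quadratureFunctional n q M) (τ + 1) x w)
    (hx : ∀ i, x i ∈ Set.Ico (-1 : ℝ) 1) (hw : ∀ i, 0 < w i) (hf : f.natDegree ≤ τ)
    (hfh : ∀ t ∈ Set.Ico (-1 : ℝ) 1, f.eval t ≤ h t) (hfx : ∀ i, f.eval (x i) = h (x i)) :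
    IsGreatest (linearProgramValues n q M τ h) (M * ∑ i, w i * h (x i)) := by
  constructor
  · refine ⟨f, hf, hfh, ?_⟩
    simp only [← hfx]
    exact hquad.mul_sum_eq hn hq hM hf
  · rintro _ ⟨g, hg, hgh, rfl⟩
    rw [← hquad.mul_sum_eq hn hq hM hg]
    gcongr with i
    · exact (hw i).le
    · exact hgh _ (hx i)

theorem IsOddQuadrature.bound_and_isGreatest (hn : 0 < n) (hq : 2 ≤ q) (hM : 0 < M)
    (hh : AbsolutelyMonotoneOn h (Set.Ico (-1) 1)) {k : ℕ} (hk : τ + 1 = 2 * k) {α ρ : Fin k → ℝ}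
    (hα : IsOddQuadrature n q M k α ρ) :
    ((M * ∑ i, ρ i * h (α i) : ℝ) : EReal) ≤ minDesignEnergy n q M τ h ∧
      IsGreatest (linearProgramValues n q M τ h) (M * ∑ i, ρ i * h (α i)) := by
  obtain ⟨-, hmem, hρ, hquad⟩ := (isOddQuadrature_iff hn hq (by omega)).1 hα
  have hmem' : ∀ i, α i ∈ Set.Ico (-1 : ℝ) 1 := fun i => Set.Ioo_subset_Ico_self (hmem i)
  obtain ⟨f, hf, hfh, hfα⟩ := exists_minorant_at_double_nodes (by norm_num) hh hmem'
  rw [← hk] at hquad hf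
  rw [← natDegree_le_iff_degree_lt_succ] at hf
  exact ⟨hquad.le_minDesignEnergy hn hq hM hf hfh hfα,
    hquad.isGreatest_linearProgramValues hn hq hM hmem' hρ hf hfh hfα⟩

theorem IsEvenQuadrature.bound_and_isGreatest (hn : 0 < n) (hq : 2 ≤ q) (hM : 0 < M)
    (hh : AbsolutelyMonotoneOn h (Set.Ico (-1) 1)) {k : ℕ} {β γ : Fin (k + 1) → ℝ}
    (hβ : IsEvenQuadrature n q M k β γ) :
    ((M * ∑ i, γ i * h (β i) : ℝ) : EReal) ≤ minDesignEnergy n q M (2 * k) h ∧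
      IsGreatest (linearProgramValues n q M (2 * k) h) (M * ∑ i, γ i * h (β i)) := by
  obtain ⟨hmono, hβ0, hβ1, hγ, hquad⟩ := (isEvenQuadrature_iff hn hq).1 hβ
  have hmem : ∀ i, β i ∈ Set.Ico (-1 : ℝ) 1 := fun i =>
    ⟨hβ0 ▸ hmono.monotone (Fin.zero_le i), hβ1 i⟩
  obtain ⟨f, hf, hfh, hfβ⟩ :=
    exists_minorant_at_left_end_and_double_nodes (by norm_num) hh hβ0 hmem
  rw [← natDegree_le_iff_degree_lt_succ] at hf
  exact ⟨hquad.le_minDesignEnergy hn hq hM hf hfh hfβ,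
    hquad.isGreatest_linearProgramValues hn hq hM hmem hγ hf hfh hfβ⟩

end EnergyBound

end HammingEnergy

end

theorem mainTheorem2_general (n q τ M : ℕ) (hq : 2 ≤ q) (hτ : τ < 2 * n)
    (hM : HammingEnergy.raoBound n q τ < M) (h : ℝ → ℝ)
    (hh : AbsolutelyMonotoneOn h (Set.Ico (-1) 1)) :
    (∀ k : ℕ, τ + 1 = 2 * k →
      (∃! p : (Fin k → ℝ) × (Fin k → ℝ), HammingEnergy.IsOddQuadrature n q M k p.1 p.2) ∧
      ∀ α ρ : Fin k → ℝ, HammingEnergy.IsOddQuadrature n q M k α ρ →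
        ((M * ∑ i, ρ i * h (α i) : ℝ) : EReal) ≤ HammingEnergy.minDesignEnergy n q M τ h ∧
        IsGreatest (HammingEnergy.linearProgramValues n q M τ h) (M * ∑ i, ρ i * h (α i))) ∧
    (∀ k : ℕ, τ = 2 * k →
      (∃! p : (Fin (k + 1) → ℝ) × (Fin (k + 1) → ℝ),
        HammingEnergy.IsEvenQuadrature n q M k p.1 p.2) ∧
      ∀ β γ : Fin (k + 1) → ℝ, HammingEnergy.IsEvenQuadrature n q M k β γ →
        ((M * ∑ i, γ i * h (β i) : ℝ) : EReal) ≤ HammingEnergy.minDesignEnergy n q M τ h ∧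
        IsGreatest (HammingEnergy.linearProgramValues n q M τ h) (M * ∑ i, γ i * h (β i))) := by
  have hn : 0 < n := by omega
  refine ⟨fun k hk => ⟨?_, fun _ _ hα => hα.bound_and_isGreatest hn hq hM.pos hh hk⟩, ?_⟩
  · rw [show τ = 2 * k - 1 by omega] at hM
    exact HammingEnergy.existsUnique_isOddQuadrature hq (by omega) (by omega) hM
  · rintro k rfl
    exact ⟨HammingEnergy.existsUnique_isEvenQuadrature hq (by omega) hM,
      fun _ _ hβ => hβ.bound_and_isGreatest hn hq hM.pos hh⟩

theorem mainTheorem2 (n q τ M : ℕ) (hn : 0 < n) (hq : 2 ≤ q) (hτ : 0 < τ) (h : ℝ → ℝ)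
    (hh : AbsolutelyMonotoneOn h (Set.Ico (-1) 1)) :
    (∀ k : ℕ, τ = 2 * k - 1 →
      M ∈ Set.Ioc (HammingEnergy.raoBound n q (2 * k - 1)) (HammingEnergy.raoBound n q (2 * k)) →
      (∃! p : (Fin k → ℝ) × (Fin k → ℝ), HammingEnergy.IsOddQuadrature n q M k p.1 p.2) ∧
      ∀ α ρ : Fin k → ℝ, HammingEnergy.IsOddQuadrature n q M k α ρ →
        ((M * ∑ i, ρ i * h (α i) : ℝ) : EReal) ≤ HammingEnergy.minDesignEnergy n q M τ h ∧
        (HammingEnergy.minDesignEnergy n q M τ h < ⊤ →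
          IsGreatest (HammingEnergy.linearProgramValues n q M τ h)
            (M * ∑ i, ρ i * h (α i)))) ∧
    (∀ k : ℕ, τ = 2 * k →
      M ∈ Set.Ioc (HammingEnergy.raoBound n q (2 * k)) (HammingEnergy.raoBound n q (2 * k + 1)) →
      (∃! p : (Fin (k + 1) → ℝ) × (Fin (k + 1) → ℝ),
        HammingEnergy.IsEvenQuadrature n q M k p.1 p.2) ∧
      ∀ β γ : Fin (k + 1) → ℝ, HammingEnergy.IsEvenQuadrature n q M k β γ →
        ((M * ∑ i, γ i * h (β i) : ℝ) : EReal) ≤ HammingEnergy.minDesignEnergy n q M τ h ∧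
        (HammingEnergy.minDesignEnergy n q M τ h < ⊤ →
          IsGreatest (HammingEnergy.linearProgramValues n q M τ h)
            (M * ∑ i, γ i * h (β i)))) := by
  have hτn {r : ℕ} (hM : M ∈ Set.Ioc (HammingEnergy.raoBound n q r)
      (HammingEnergy.raoBound n q (r + 1))) : r < 2 * n :=
    HammingEnergy.lt_two_mul_of_raoBound_lt hn (by omega) (hM.1.trans_le hM.2)
  constructor
  · rintro k rfl hM
    rw [← Nat.sub_add_cancel (show 1 ≤ 2 * k by omega), Nat.add_sub_cancel] at hM
    obtain ⟨hunique, hbound⟩ :=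
      (mainTheorem2_general n q _ M hq (hτn hM) hM.1 h hh).1 k (by omega)
    exact ⟨hunique, fun α ρ hα => ⟨(hbound α ρ hα).1, fun _ => (hbound α ρ hα).2⟩⟩
  · rintro k rfl hM
    obtain ⟨hunique, hbound⟩ := (mainTheorem2_general n q _ M hq (hτn hM) hM.1 h hh).2 k rfl
    exact ⟨hunique, fun β γ hβ => ⟨(hbound β γ hβ).1, fun _ => (hbound β γ hβ).2⟩⟩
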